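/- **Slater determinant model.** For $m\ge 0$ let $\gamma_m(\zeta)=(\pi\, m!)^{-1/2}\,\overline{\zeta}^{\,m}e^{-|\zeta|^2/2}$, $\zeta\in\mathbb C$, be the Landau states of the lowest Landau band (field strength scaled to $1$), and for $N\ge 1$ let $$\Upsilon_N(\zeta_1,\dots,\zeta_N)=\frac1{\sqrt{N!}}\det\big(\gamma_{k-1}(\zeta_j)\big)_{j,k=1}^N .$$ Define the effective one-dimensional potentials $$V_j(x)=\int_{\mathbb C^N}\frac{|\Upsilon_N(\zeta)|^2}{\sqrt{x^2+|\zeta_j|^2}}\,d\zeta,\qquad W_{jk}(x)=\int_{\mathbb C^N}\frac{|\Upsilon_N(\zeta)|^2}{\sqrt{x^2+|\zeta_j-\zeta_k|^2}}\,d\zeta\quad(j\ne k),$$ and, for $Z,B>0$, the Hamiltonian on $L^2(\mathbb R^N)$ $$h^{\rm det}(N,Z,B^{-1/2})=\sum_{j=1}^N\Big[-\sqrt B\,\frac{d^2}{dx_j^2}-Z\,V_j(x_j)\Big]+\sum_{1\le j<k\le N}W_{jk}(x_j-x_k).$$ Its ground state energy is the infimum of $\langle\Phi,h\Phi\rangle$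 over $\Phi\in C_c^\infty(\mathbb R^N)$ with $\|\Phi\|_{L^2}=1$. We say that $h^{\rm det}(N,Z,B^{-1/2})$ has a bound state if this ground state energy is strictly smaller than the ground state energy of the $(N-1)$-electron Hamiltonian obtained from it by omitting all terms that involve one of the variables $x_i$ (keeping the potentials $V_j,W_{jk}$ of $\Upsilon_N$; by antisymmetry of $\Upsilon_N$ the choice of $i$ does not matter, and for $N=1$ the latter energy is $0$). Let $N_{\max}(Z,B)$ be the largest $N\ge1$ for which $h^{\rm det}(N,Z,B^{-1/2})$ has a bound state (and $0$ if there is none). Then: 1. For all constants $a_1,a_2>0$ and every $\alpha>0$ there is a constant $A_\alpha>0$ such that for every $\varepsilon>0$, every real $Z\ge1$ and every $B$ with $a_1e^{Z^{\alpha/4}}>B\ge a_2Z^{3+\varepsilon}$, the number $N_{\max}(Z,B)$ is finite and $$N_{\max}(Z,B)\le 4Z+A_\alpha Z^{1+\alpha}.$$ 2. For all $a>0$ and $p>3$ there is a constant $A>0$ (depending on $a,p$) such that for every real $Z\ge2$ and $B=aZ^p$, the number $N_{\max}(Z,B)$ is finite and $$N_{\max}(Z,B)\le 6Z+A\,Z(\log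 Z)^2 .$$ -/

import Mathlib

open MeasureTheory
open scoped ContDiff

namespace SlaterModel

/-- The Landau state of angular momentum `-m` in the lowest Landau band, in the
variable `ζ = y + i z` and for field strength `1` (the field strength is scaled out):
`γ_m(ζ) = (π m!)^{-1/2} conj(ζ)^m exp(-|ζ|²/2)`. -/
noncomputable def landau (m : ℕ) (ζ : ℂ) : ℂ :=
  (((Real.sqrt (Real.pi * (m.factorial : ℝ)))⁻¹ * Real.exp (-(‖ζ‖ ^ 2) / 2) : ℝ) : ℂ)
    * (starRingEnd ℂ ζ) ^ m

/-- The Slater determinant `Υ = (N!)^{-1/2} γ_0 ∧ ⋯ ∧ γ_{N-1}`. -/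
noncomputable def slater (N : ℕ) (ζ : Fin N → ℂ) : ℂ :=
  (((Real.sqrt (N.factorial : ℝ))⁻¹ : ℝ) : ℂ)
    * Matrix.det (Matrix.of fun j k : Fin N => landau (k : ℕ) (ζ j))

/-- Effective one-dimensional nuclear potential of an `N`-particle state `U` of the transverse
variables: `⟨U, |r_j|⁻¹ U⟩`, where `|r_j| = (x² + |ζ_j|²)^{1/2}`. -/
noncomputable def effV {N : ℕ} (U : (Fin N → ℂ) → ℂ) (j : Fin N) (x : ℝ) : ℝ :=
  ∫ ζ : Fin N → ℂ, ‖U ζ‖ ^ 2 / Real.sqrt (x ^ 2 + ‖ζ j‖ ^ 2)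

/-- Effective one-dimensional pair interaction of the state `U`: `⟨U, |r_j - r_k|⁻¹ U⟩`,
as a function of the longitudinal separation `x = x_j - x_k`. -/
noncomputable def effW {N : ℕ} (U : (Fin N → ℂ) → ℂ) (j k : Fin N) (x : ℝ) : ℝ :=
  ∫ ζ : Fin N → ℂ, ‖U ζ‖ ^ 2 / Real.sqrt (x ^ 2 + ‖ζ j - ζ k‖ ^ 2)

section Hamiltonian

variable {ι : Type} [Fintype ι] [LinearOrder ι]

/-- The potential `-Z ∑_j V_j(x_j) + ∑_{j<k} W_{jk}(x_j - x_k)`, for particles labelled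
by `ι`. -/
noncomputable def potential (Z : ℝ) (V : ι → ℝ → ℝ) (W : ι → ι → ℝ → ℝ) (x : ι → ℝ) : ℝ :=
  -Z * ∑ j, V j (x j) + ∑ j, ∑ k, if j < k then W j k (x j - x k) else 0

/-- The quadratic form `⟨Φ, h Φ⟩` of
`h = ∑_j [-M⁻¹ d²/dx_j² - Z V_j(x_j)] + ∑_{j<k} W_{jk}(x_j - x_k)`. -/
noncomputable def energy (Z M : ℝ) (V : ι → ℝ → ℝ) (W : ι → ι → ℝ → ℝ)
    (Φ : (ι → ℝ) → ℂ) : ℝ :=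
  ∫ x : ι → ℝ, ((1 / M) * ∑ j, ‖fderiv ℝ Φ x (Pi.single j 1)‖ ^ 2
    + potential Z V W x * ‖Φ x‖ ^ 2)

/-- The ground state energy of `h`: the infimum of `⟨Φ, h Φ⟩` over normalized `Φ`
in `C_c^∞`. For bounded potentials this is a form core, so this is the bottom of the
spectrum of `h`. -/
noncomputable def groundEnergy (Z M : ℝ) (V : ι → ℝ → ℝ) (W : ι → ι → ℝ → ℝ) : ℝ :=
  sInf {E : ℝ | ∃ Φ : (ι → ℝ) → ℂ, ContDiff ℝ ∞ Φ ∧ HasCompactSupport Φ ∧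
    ∫ x : ι → ℝ, ‖Φ x‖ ^ 2 = 1 ∧ E = energy Z M V W Φ}

end Hamiltonian

/-- Ground state energy of the `N`-electron Hamiltonian `h^det(N, Z, M)`. -/
noncomputable def detEnergy (N : ℕ) (Z M : ℝ) : ℝ :=
  groundEnergy Z M (effV (slater N)) (effW (slater N))

/-- Ground state energy of the `(N-1)`-electron Hamiltonian obtained from `h^det(N, Z, M)` by
omitting all terms that involve the variable `x_i`, the effective potentials still being those
of the `N`-particle determinant. -/
noncomputable def detEnergyOmit (N : ℕ) (i : Fin N) (Z M : ℝ) : ℝ :=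
  groundEnergy (ι := {j : Fin N // j ≠ i}) Z M (fun j => effV (slater N) j)
    (fun j k => effW (slater N) j k)

/-- The numbers `N ≥ 1` of electrons for which `h^det(N, Z, B^{-1/2})` has a bound state:
its ground state energy is strictly below that of the system with one electron removed.
(By antisymmetry of the determinant, the latter does not depend on the removed electron `i`.) -/
def boundNumbers (Z B : ℝ) : Set ℕ :=
  {N : ℕ | 1 ≤ N ∧ ∀ i : Fin N,
    detEnergy N Z (B ^ (-(1 / 2) : ℝ)) < detEnergyOmit N i Z (B ^ (-(1 / 2) : ℝ))}

/-- `N_max(Z, B)`: the largest number of electrons that can be bound (meaningful when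
`boundNumbers Z B` is bounded). -/
noncomputable def Nmax (Z B : ℝ) : ℕ := sSup (boundNumbers Z B)

end SlaterModel

-- The argument is that of Benguria and Lieb: test the Euler-Lagrange equation of a bound state
-- against a distance times the state. Here the distance is √(t² + N), because the determinant
-- smears every charge over a disk of radius of order √N.
--
-- Suppose N electrons are bound, let Φ nearly minimize the energy, and let G be the sum over the
-- particles of a bounded version w of √(t² + N). The quantity ∫ G (energy density - E |Φ|²) is
-- estimated twice. From above, the competitor √(1 - sG) Φ shows that it is at most (1/M) ∑ ∫ |Φ|
-- |∂_j Φ| up to small errors (`integral_mul_energyDensity_sub_le`). From below, taking particle i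
-- away costs a positive binding energy, so only the terms of the potential that involve i matter
-- (`le_integral_sum_weight_mul`). The attraction contributes at least -8ZN, since w V ≤ 8. The
-- repulsion, helped by the binding energy when some particle is far out, contributes at least
-- N(N-1)/3, since W(x) ≥ (x² + 4N)^(-1/2) and √((t-u)² + 4N) ≤ √(t² + N) + √(u² + N).
--
-- The gradient term needs a bound on the kinetic energy. The function (1 + x²)^(-1/2) is the
-- derivative of arsinh; truncating arsinh at height S makes the attraction form bounded by ∫ |Φ|
-- |∂_j Φ| with a constant of order S, up to an error of order exp(-S). Since E ≤ 0, because the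
-- particles can be spread out, the gradient term is O(N Z S), and `card_le_of_bound` gives N ≤ 8000
-- Z S as soon as exp(-S) ≤ M = B^(-1/2).
--
-- The properties of V and W come from explicit facts on the Landau states: their densities add up
-- to at most 1/π, the second moment in the determinant is at most N, and the determinant vanishes
-- at coincidences. With S = 1 + log(1 + √B) both claims follow from this single estimate: S is
-- bounded by a multiple of Z^α or of (log Z)², the constant A absorbs the rest, and the terms 4Z
-- and 6Z are spare.

namespace SlaterModel

set_option linter.unusedSectionVars false

-- Test functions, bounded potentials and integrability

section Abstract

variable {ι : Type} [Fintype ι] [LinearOrder ι]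

/-- Smooth compactly supported wave functions. -/
structure TestFunction (Φ : (ι → ℝ) → ℂ) : Prop where
  contDiff : ContDiff ℝ ∞ Φ
  hasCompactSupport : HasCompactSupport Φ

/-- The modulus of the `j`-th partial derivative. -/
noncomputable def partialNorm (Φ : (ι → ℝ) → ℂ) (j : ι) (x : ι → ℝ) : ℝ :=
  ‖fderiv ℝ Φ x (Pi.single j 1)‖

/-- Measurable, nonnegative potentials bounded by a common constant. -/
structure BoundedPotentials (V : ι → ℝ → ℝ) (W : ι → ι → ℝ → ℝ) (C : ℝ) : Prop where
  measurable_V : ∀ j, Measurable (V j)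
  measurable_W : ∀ j k, Measurable (W j k)
  V_nonneg : ∀ j x, 0 ≤ V j x
  V_le : ∀ j x, V j x ≤ C
  W_nonneg : ∀ j k x, 0 ≤ W j k x
  -- Restricted to j < k because on the diagonal the effective interaction of the determinant is
  -- 1/|x|, which is unbounded.
  W_le : ∀ j k x, j < k → W j k x ≤ C

/-- The integrand of the quadratic form `energy`. -/
noncomputable def energyDensity (Z M : ℝ) (V : ι → ℝ → ℝ) (W : ι → ι → ℝ → ℝ)
    (Φ : (ι → ℝ) → ℂ) (x : ι → ℝ) : ℝ :=
  (1 / M) * ∑ j, partialNorm Φ j x ^ 2 + potential Z V W x * ‖Φ x‖ ^ 2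

theorem energy_eq_integral (Z M : ℝ) (V : ι → ℝ → ℝ) (W : ι → ι → ℝ → ℝ)
    (Φ : (ι → ℝ) → ℂ) : energy Z M V W Φ = ∫ x, energyDensity Z M V W Φ x := rfl

theorem partialNorm_nonneg (Φ : (ι → ℝ) → ℂ) (j : ι) (x : ι → ℝ) : 0 ≤ partialNorm Φ j x :=
  norm_nonneg _

namespace TestFunction

variable {Φ : (ι → ℝ) → ℂ}

theorem differentiable (h : TestFunction Φ) : Differentiable ℝ Φ :=
  h.contDiff.differentiable (by simp)

theorem continuous (h : TestFunction Φ) : Continuous Φ := h.contDiff.continuous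

theorem continuous_partialNorm (h : TestFunction Φ) (j : ι) : Continuous (partialNorm Φ j) := by
  have := h.contDiff.continuous_fderiv (by simp)
  unfold partialNorm
  fun_prop

theorem hasCompactSupport_partialNorm (h : TestFunction Φ) (j : ι) :
    HasCompactSupport (partialNorm Φ j) := by
  have := (h.hasCompactSupport.fderiv (𝕜 := ℝ))
  exact this.comp_left (g := fun L : (ι → ℝ) →L[ℝ] ℂ => ‖L (Pi.single j 1)‖) (by simp)

/-- A bounded measurable factor times a continuous compactly supported one is integrable. -/
theorem _root_.MeasureTheory.integrable_mul_of_bounded_of_hasCompactSupport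
    {f g : (ι → ℝ) → ℝ} {C : ℝ} (hf : Measurable f) (hC : ∀ x, |f x| ≤ C)
    (hg : Continuous g) (hgc : HasCompactSupport g) : Integrable (fun x => f x * g x) :=
  (hg.integrable_of_hasCompactSupport hgc).bdd_mul hf.aestronglyMeasurable
    (Filter.Eventually.of_forall hC)

theorem continuous_normSq (h : TestFunction Φ) : Continuous (fun x => ‖Φ x‖ ^ 2) := by
  have := h.continuous
  fun_prop

theorem hasCompactSupport_normSq (h : TestFunction Φ) :
    HasCompactSupport (fun x => ‖Φ x‖ ^ 2) :=
  h.hasCompactSupport.comp_left (g := fun z : ℂ => ‖z‖ ^ 2) (by simp)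

theorem integrable_mul_normSq (h : TestFunction Φ) {f : (ι → ℝ) → ℝ} {C : ℝ}
    (hf : Measurable f) (hC : ∀ x, |f x| ≤ C) : Integrable (fun x => f x * ‖Φ x‖ ^ 2) :=
  integrable_mul_of_bounded_of_hasCompactSupport hf hC h.continuous_normSq
    h.hasCompactSupport_normSq

theorem integrable_mul_partialNormSq (h : TestFunction Φ) (j : ι) {f : (ι → ℝ) → ℝ} {C : ℝ}
    (hf : Measurable f) (hC : ∀ x, |f x| ≤ C) :
    Integrable (fun x => f x * partialNorm Φ j x ^ 2) :=
  integrable_mul_of_bounded_of_hasCompactSupport hf hC ((h.continuous_partialNorm j).pow 2)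
    ((h.hasCompactSupport_partialNorm j).comp_left (g := fun z : ℝ => z ^ 2) (by simp))

theorem integrable_mul_norm_mul_partialNorm (h : TestFunction Φ) (j : ι) {f : (ι → ℝ) → ℝ} {C : ℝ}
    (hf : Measurable f) (hC : ∀ x, |f x| ≤ C) :
    Integrable (fun x => f x * (‖Φ x‖ * partialNorm Φ j x)) :=
  integrable_mul_of_bounded_of_hasCompactSupport hf hC
    (h.continuous.norm.mul (h.continuous_partialNorm j))
    ((h.hasCompactSupport_partialNorm j).mul_left)

theorem integrable_normSq (h : TestFunction Φ) : Integrable (fun x => ‖Φ x‖ ^ 2) :=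
  h.continuous_normSq.integrable_of_hasCompactSupport h.hasCompactSupport_normSq

theorem integrable_partialNormSq (h : TestFunction Φ) (j : ι) :
    Integrable (fun x => partialNorm Φ j x ^ 2) := by
  simpa using h.integrable_mul_partialNormSq j (f := fun _ => 1) (C := 1) measurable_const
    (by simp)

theorem integrable_norm_mul_partialNorm (h : TestFunction Φ) (j : ι) :
    Integrable (fun x => ‖Φ x‖ * partialNorm Φ j x) := by
  simpa using h.integrable_mul_norm_mul_partialNorm j (f := fun _ => 1) (C := 1) measurable_const
    (by simp)

/-- The product of a real smooth function and a test function is a test function. -/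
theorem smul (h : TestFunction Φ) {f : (ι → ℝ) → ℝ} (hf : ContDiff ℝ ∞ f) :
    TestFunction (fun x => f x • Φ x) where
  contDiff := ContDiff.smul hf h.contDiff
  hasCompactSupport := HasCompactSupport.smul_left (f := f) h.hasCompactSupport

end TestFunction

namespace BoundedPotentials

variable {V : ι → ℝ → ℝ} {W : ι → ι → ℝ → ℝ} {C : ℝ}

theorem measurable_potential (h : BoundedPotentials V W C) (Z : ℝ) :
    Measurable (potential Z V W) := by
  have h1 := h.measurable_V
  have h2 := h.measurable_W
  unfold potential
  refine Measurable.add ?_ ?_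
  · refine measurable_const.mul (Finset.measurable_sum _ fun j _ => ?_)
    exact (h1 j).comp (measurable_pi_apply j)
  · refine Finset.measurable_sum _ fun j _ => Finset.measurable_sum _ fun k _ => ?_
    split_ifs
    · exact (h2 j k).comp ((measurable_pi_apply j).sub (measurable_pi_apply k))
    · exact measurable_const

theorem exists_abs_potential_le (h : BoundedPotentials V W C) (Z : ℝ) :
    ∃ D, ∀ x, |potential Z V W x| ≤ D := by
  refine ⟨|(-Z)| * ∑ _j : ι, C + ∑ _j : ι, ∑ _k : ι, C, fun x => ?_⟩
  unfold potential
  refine (abs_add_le _ _).trans (add_le_add ?_ ?_)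
  · rw [abs_mul]
    refine mul_le_mul_of_nonneg_left ((Finset.abs_sum_le_sum_abs _ _).trans
      (Finset.sum_le_sum fun j _ => ?_)) (abs_nonneg _)
    rw [abs_of_nonneg (h.V_nonneg _ _)]
    exact h.V_le _ _
  · refine (Finset.abs_sum_le_sum_abs _ _).trans (Finset.sum_le_sum fun j _ =>
      (Finset.abs_sum_le_sum_abs _ _).trans (Finset.sum_le_sum fun k _ => ?_))
    split_ifs
    · rw [abs_of_nonneg (h.W_nonneg _ _ _)]
      exact h.W_le _ _ _ ‹_›
    · simpa using (h.V_nonneg j 0).trans (h.V_le j 0)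

theorem integrable_mul_energyDensity (h : BoundedPotentials V W C) (Z M : ℝ)
    {Φ : (ι → ℝ) → ℂ} (hΦ : TestFunction Φ) {f : (ι → ℝ) → ℝ} {D : ℝ}
    (hf : Measurable f) (hD : ∀ x, |f x| ≤ D) :
    Integrable (fun x => f x * energyDensity Z M V W Φ x) := by
  obtain ⟨D', hD'⟩ := h.exists_abs_potential_le Z
  have h1 : Integrable (fun x => ∑ j, f x * partialNorm Φ j x ^ 2) :=
    integrable_finsetSum _ fun j _ => hΦ.integrable_mul_partialNormSq j hf hD
  have h2 : Integrable (fun x => (f x * potential Z V W x) * ‖Φ x‖ ^ 2) :=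
    hΦ.integrable_mul_normSq (hf.mul (h.measurable_potential Z)) (C := D * D') fun x => by
      rw [abs_mul]
      exact mul_le_mul (hD x) (hD' x) (abs_nonneg _) ((abs_nonneg _).trans (hD x))
  refine ((h1.const_mul (1 / M)).add h2).congr (Filter.Eventually.of_forall fun x => ?_)
  simp only [energyDensity, Pi.add_apply, ← Finset.mul_sum]
  ring

theorem integrable_energyDensity (h : BoundedPotentials V W C) (Z M : ℝ)
    {Φ : (ι → ℝ) → ℂ} (hΦ : TestFunction Φ) : Integrable (energyDensity Z M V W Φ) := by
  simpa using h.integrable_mul_energyDensity Z M hΦ (f := fun _ => 1) (D := 1) measurable_const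
    (by simp)

end BoundedPotentials

-- Logarithmic form bound for the one-dimensional Coulomb potential

/-- A bounded function whose derivative is comparable to `(1 + x²)^{-1/2}` on an exponentially
large interval. -/
noncomputable def truncatedArsinh (S x : ℝ) : ℝ := S * Real.arctan (Real.arsinh x / S)

noncomputable def truncatedArsinhDeriv (S x : ℝ) : ℝ :=
  (√(1 + x ^ 2))⁻¹ * (1 / (1 + (Real.arsinh x / S) ^ 2))

theorem hasDerivAt_truncatedArsinh {S : ℝ} (hS : 0 < S) (x : ℝ) :
    HasDerivAt (truncatedArsinh S) (truncatedArsinhDeriv S x) x := by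
  have := (((Real.hasDerivAt_arsinh x).div_const S).arctan).const_mul S
  refine this.congr_deriv ?_
  unfold truncatedArsinhDeriv
  field_simp

theorem abs_truncatedArsinh_le {S : ℝ} (hS : 0 < S) (x : ℝ) : |truncatedArsinh S x| ≤ 2 * S := by
  unfold truncatedArsinh
  rw [abs_mul, abs_of_pos hS, mul_comm]
  refine mul_le_mul_of_nonneg_right ?_ hS.le
  have h1 := Real.arctan_lt_pi_div_two (Real.arsinh x / S)
  have h2 := Real.neg_pi_div_two_lt_arctan (Real.arsinh x / S)
  have := Real.pi_lt_four
  exact abs_le.2 ⟨by linarith, by linarith⟩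

theorem truncatedArsinhDeriv_nonneg (S x : ℝ) : 0 ≤ truncatedArsinhDeriv S x := by
  unfold truncatedArsinhDeriv
  positivity

theorem truncatedArsinhDeriv_le_one (S x : ℝ) : truncatedArsinhDeriv S x ≤ 1 := by
  unfold truncatedArsinhDeriv
  refine mul_le_one₀ (inv_le_one_of_one_le₀ ?_) (by positivity) ?_
  · exact Real.one_le_sqrt.2 (by nlinarith [sq_nonneg x])
  · exact (div_le_one (by positivity)).2 (by nlinarith [sq_nonneg (Real.arsinh x / S)])

/-- Where |arsinh x| ≤ S the damping factor is at least 1/2; elsewhere √(1 + x²) = cosh(arsinh x) is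
at least exp(S)/2. -/
theorem inv_sqrt_one_add_sq_le {S : ℝ} (hS : 0 < S) (x : ℝ) :
    (√(1 + x ^ 2))⁻¹ ≤ 2 * truncatedArsinhDeriv S x + 2 * Real.exp (-S) := by
  have hs : 0 < √(1 + x ^ 2) := Real.sqrt_pos.2 (by positivity)
  rcases le_or_gt |Real.arsinh x| S with h | h
  · have h1 : (Real.arsinh x / S) ^ 2 ≤ 1 := by
      rw [sq_le_one_iff_abs_le_one, abs_div, abs_of_pos hS]
      exact (div_le_one hS).2 h
    have h2 : (1 : ℝ) / 2 ≤ 1 / (1 + (Real.arsinh x / S) ^ 2) :=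
      one_div_le_one_div_of_le (by positivity) (by linarith)
    have h3 : (√(1 + x ^ 2))⁻¹ * (1 / 2) ≤ truncatedArsinhDeriv S x :=
      mul_le_mul_of_nonneg_left h2 (by positivity)
    have := Real.exp_pos (-S)
    linarith
  · have h1 : √(1 + x ^ 2) = Real.cosh (Real.arsinh x) := (Real.cosh_arsinh x).symm
    have h2 : Real.exp S / 2 ≤ √(1 + x ^ 2) := by
      rw [h1, ← Real.cosh_abs, Real.cosh_eq]
      have := Real.exp_le_exp.2 h.le
      have := Real.exp_pos (-|Real.arsinh x|)
      linarith
    have h3 : (√(1 + x ^ 2))⁻¹ ≤ 2 * Real.exp (-S) := by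
      rw [Real.exp_neg]
      calc (√(1 + x ^ 2))⁻¹ ≤ (Real.exp S / 2)⁻¹ :=
            inv_anti₀ (by positivity) h2
        _ = 2 * (Real.exp S)⁻¹ := by field_simp
    have := truncatedArsinhDeriv_nonneg S x
    linarith

theorem measurable_truncatedArsinhDeriv (S : ℝ) : Measurable (truncatedArsinhDeriv S) := by
  unfold truncatedArsinhDeriv
  have : Measurable Real.arsinh := Real.continuous_arsinh.measurable
  fun_prop

/-- A one-dimensional Coulomb-like potential in the variable `x_j` is form bounded by the square
root of the kinetic energy, with a logarithmic constant. -/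
theorem TestFunction.integral_truncatedArsinhDeriv_le {Φ : (ι → ℝ) → ℂ} (hΦ : TestFunction Φ)
    {S : ℝ} (hS : 0 < S) (j : ι) :
    ∫ x, truncatedArsinhDeriv S (x j) * ‖Φ x‖ ^ 2 ≤
      4 * S * ∫ x, ‖Φ x‖ * partialNorm Φ j x := by
  have hdH : ∀ x : ι → ℝ, HasFDerivAt (fun x : ι → ℝ => truncatedArsinh S (x j))
      (truncatedArsinhDeriv S (x j) • ContinuousLinearMap.proj (R := ℝ) (φ := fun _ : ι => ℝ) j) x :=
    fun x => HasDerivAt.comp_hasFDerivAt (h₂ := truncatedArsinh S) (f := fun x : ι → ℝ => x j) x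
      (hasDerivAt_truncatedArsinh hS (x j))
      (ContinuousLinearMap.proj (R := ℝ) (φ := fun _ : ι => ℝ) j).hasFDerivAt
  have hdΦ : ∀ x, HasFDerivAt (fun x => ‖Φ x‖ ^ 2)
      (2 • (innerSL ℝ (Φ x)).comp (fderiv ℝ Φ x)) x :=
    fun x => (hΦ.differentiable x).hasFDerivAt.norm_sq
  have hmeas : Measurable fun x : ι → ℝ => truncatedArsinh S (x j) := by
    have : Continuous (truncatedArsinh S) :=
      continuous_iff_continuousAt.2 fun x => (hasDerivAt_truncatedArsinh hS x).continuousAt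
    exact this.measurable.comp (measurable_pi_apply j)
  have hcs : HasCompactSupport fun x => inner ℝ (Φ x) (fderiv ℝ Φ x (Pi.single j 1)) :=
    hΦ.hasCompactSupport.mono' <| by
      intro x hx
      by_contra h
      exact hx (by simp [Function.notMem_support.1 fun h' => h (subset_tsupport _ h')])
  have hcont : Continuous fun x => inner ℝ (Φ x) (fderiv ℝ Φ x (Pi.single j 1)) := by
    have h1 := hΦ.contDiff.continuous_fderiv (by simp)
    have h2 := hΦ.continuous
    fun_prop
  have hint : Integrable fun x : ι → ℝ =>
      truncatedArsinh S (x j) * inner ℝ (Φ x) (fderiv ℝ Φ x (Pi.single j 1)) :=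
    integrable_mul_of_bounded_of_hasCompactSupport hmeas
      (fun x => abs_truncatedArsinh_le hS (x j)) hcont hcs
  -- Integration by parts moves the derivative onto |Φ|²; the bound 2S on the primitive, times the
  -- factor 2 from differentiating the square, gives 4S.
  have key := integral_bilinear_hasFDerivAt_right_eq_neg_left_of_integrable (μ := volume)
    (B := ContinuousLinearMap.mul ℝ ℝ) (v := Pi.single j (1 : ℝ))
    (f := fun x : ι → ℝ => truncatedArsinh S (x j)) (g := fun x => ‖Φ x‖ ^ 2)
    (f' := fun x => truncatedArsinhDeriv S (x j) •
      ContinuousLinearMap.proj (R := ℝ) (φ := fun _ : ι => ℝ) j)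
    (g' := fun x => 2 • (innerSL ℝ (Φ x)).comp (fderiv ℝ Φ x))
    (by
      simpa using hΦ.integrable_mul_normSq (f := fun x => truncatedArsinhDeriv S (x j)) (C := 1)
        ((measurable_truncatedArsinhDeriv S).comp (measurable_pi_apply j))
        (fun x => by
          rw [abs_of_nonneg (truncatedArsinhDeriv_nonneg _ _)]
          exact truncatedArsinhDeriv_le_one _ _))
    (by
      refine (hint.const_mul 2).congr (Filter.Eventually.of_forall fun x => ?_)
      simp
      ring)
    (by
      simpa using hΦ.integrable_mul_normSq hmeas (fun x => abs_truncatedArsinh_le hS (x j)))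
    (fun x _ => hdH x) (fun x _ => hdΦ x)
  simp only [ContinuousLinearMap.mul_apply', smul_apply,
    ContinuousLinearMap.proj_apply, Pi.single_eq_same, smul_eq_mul, mul_one] at key
  rw [← neg_eq_iff_eq_neg, ← integral_neg] at key
  rw [← key, ← integral_const_mul]
  refine integral_mono ?_ ((hΦ.integrable_norm_mul_partialNorm j).const_mul (4 * S)) fun x => ?_
  · refine (hint.const_mul (-2)).congr (Filter.Eventually.of_forall fun x => ?_)
    simp
    ring
  · have h1 := abs_truncatedArsinh_le hS (x j)
    have h2 := abs_real_inner_le_norm (Φ x) (fderiv ℝ Φ x (Pi.single j 1))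
    have h3 : |truncatedArsinh S (x j) * inner ℝ (Φ x) (fderiv ℝ Φ x (Pi.single j 1))| ≤
        2 * S * (‖Φ x‖ * partialNorm Φ j x) := by
      rw [abs_mul]
      exact mul_le_mul h1 h2 (abs_nonneg _) (by positivity)
    have h4 := (abs_le.1 h3).1
    calc _ = -2 * (truncatedArsinh S (x j) *
          inner ℝ (Φ x) (fderiv ℝ Φ x (Pi.single j 1))) := by simp; ring
      _ ≤ 4 * S * (‖Φ x‖ * partialNorm Φ j x) := by linarith

end Abstract

-- Lower bound of the energy, variational principle and sign of the ground state energy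

section Abstract

variable {ι : Type} [Fintype ι] [LinearOrder ι]
variable {V : ι → ℝ → ℝ} {W : ι → ι → ℝ → ℝ} {C Z M S : ℝ}

theorem neg_sum_V_le_potential (h : BoundedPotentials V W C) (x : ι → ℝ) :
    -Z * ∑ j, V j (x j) ≤ potential Z V W x := by
  have : 0 ≤ ∑ j, ∑ k, if j < k then W j k (x j - x k) else 0 :=
    Finset.sum_nonneg fun j _ => Finset.sum_nonneg fun k _ => by
      split_ifs
      exacts [h.W_nonneg _ _ _, le_rfl]
  unfold potential
  linarith

/-- The energy controls half of the kinetic energy. -/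
theorem BoundedPotentials.energy_lower_bound (h : BoundedPotentials V W C)
    (hV : ∀ j x, V j x ≤ 8 * (√(1 + x ^ 2))⁻¹) (hZ : 0 < Z) (hM : 0 < M) (hS : 0 < S)
    {Φ : (ι → ℝ) → ℂ} (hΦ : TestFunction Φ) :
    1 / (2 * M) * ∑ j, (∫ x, partialNorm Φ j x ^ 2) -
      Fintype.card ι * ((64 * Z * S) ^ 2 * M / 2 + 16 * Z * Real.exp (-S)) * ∫ x, ‖Φ x‖ ^ 2 ≤
      energy Z M V W Φ := by
  have hH : ∀ j : ι, Integrable fun x : ι → ℝ => truncatedArsinhDeriv S (x j) * ‖Φ x‖ ^ 2 :=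
    fun j => hΦ.integrable_mul_normSq (C := 1)
      ((measurable_truncatedArsinhDeriv S).comp (measurable_pi_apply j))
      (fun x => by
        rw [abs_of_nonneg (truncatedArsinhDeriv_nonneg _ _)]
        exact truncatedArsinhDeriv_le_one _ _)
  have hp := hΦ.integrable_partialNormSq
  have hn := hΦ.integrable_normSq
  have hm := hΦ.integrable_norm_mul_partialNorm
  have hi : ∀ j : ι, Integrable fun x => 1 / M * partialNorm Φ j x ^ 2 -
      16 * Z * (truncatedArsinhDeriv S (x j) * ‖Φ x‖ ^ 2) -
      16 * Z * Real.exp (-S) * ‖Φ x‖ ^ 2 := fun j =>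
    (((hp j).const_mul _).sub ((hH j).const_mul _)).sub (hn.const_mul _)
  have hle : ∑ j, ∫ x, (1 / M * partialNorm Φ j x ^ 2 -
      16 * Z * (truncatedArsinhDeriv S (x j) * ‖Φ x‖ ^ 2) -
      16 * Z * Real.exp (-S) * ‖Φ x‖ ^ 2) ≤ energy Z M V W Φ := by
    rw [energy_eq_integral, ← integral_finsetSum _ fun j _ => hi j]
    refine integral_mono (integrable_finsetSum _ fun j _ => hi j)
      (h.integrable_energyDensity Z M hΦ) fun x => ?_
    have h1 := neg_sum_V_le_potential (Z := Z) h x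
    have h2 : ∑ j, V j (x j) ≤
        ∑ j, (16 * truncatedArsinhDeriv S (x j) + 16 * Real.exp (-S)) :=
      Finset.sum_le_sum fun j _ => by
        have := hV j (x j)
        have := inv_sqrt_one_add_sq_le hS (x j)
        linarith
    have h3 : -Z * ∑ j, (16 * truncatedArsinhDeriv S (x j) + 16 * Real.exp (-S)) ≤
        potential Z V W x := (by nlinarith : _ ≤ -Z * ∑ j, V j (x j)).trans h1
    have h4 := mul_le_mul_of_nonneg_right h3 (sq_nonneg ‖Φ x‖)
    unfold energyDensity
    calc _ = 1 / M * ∑ j, partialNorm Φ j x ^ 2 +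
          (-Z * ∑ j, (16 * truncatedArsinhDeriv S (x j) + 16 * Real.exp (-S))) * ‖Φ x‖ ^ 2 := by
          rw [Finset.mul_sum, Finset.mul_sum, Finset.sum_mul, ← Finset.sum_add_distrib]
          exact Finset.sum_congr rfl fun j _ => by ring
      _ ≤ _ := by linarith
  refine le_trans ?_ hle
  have hcard : (Fintype.card ι : ℝ) * ((64 * Z * S) ^ 2 * M / 2 + 16 * Z * Real.exp (-S)) *
      ∫ x, ‖Φ x‖ ^ 2 =
      ∑ _j : ι, ((64 * Z * S) ^ 2 * M / 2 + 16 * Z * Real.exp (-S)) * ∫ x, ‖Φ x‖ ^ 2 := by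
    rw [Finset.sum_const, Finset.card_univ, nsmul_eq_mul]
    ring
  rw [hcard, Finset.mul_sum, ← Finset.sum_sub_distrib]
  refine Finset.sum_le_sum fun j _ => ?_
  have hi' : Integrable fun x => 1 / M * partialNorm Φ j x ^ 2 -
      16 * Z * (truncatedArsinhDeriv S (x j) * ‖Φ x‖ ^ 2) :=
    ((hp j).const_mul _).sub ((hH j).const_mul _)
  rw [integral_sub hi' (hn.const_mul _),
    integral_sub ((hp j).const_mul _) ((hH j).const_mul _), integral_const_mul,
    integral_const_mul, integral_const_mul]
  have h1 := hΦ.integral_truncatedArsinhDeriv_le hS j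
  -- Young's inequality: half of the kinetic energy pays for the attraction. The factor 64 is 16
  -- from V times 4 from the integration by parts.
  have h2 : ∫ x, 64 * Z * S * (‖Φ x‖ * partialNorm Φ j x) ≤
      ∫ x, (1 / (2 * M) * partialNorm Φ j x ^ 2 + (64 * Z * S) ^ 2 * M / 2 * ‖Φ x‖ ^ 2) := by
    refine integral_mono ((hm j).const_mul _) (((hp j).const_mul _).add (hn.const_mul _))
      fun x => ?_
    have : 1 / (2 * M) * partialNorm Φ j x ^ 2 + (64 * Z * S) ^ 2 * M / 2 * ‖Φ x‖ ^ 2 -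
        64 * Z * S * (‖Φ x‖ * partialNorm Φ j x) =
        1 / (2 * M) * (partialNorm Φ j x - 64 * Z * S * M * ‖Φ x‖) ^ 2 := by
      field_simp
      ring
    have h0 : 0 ≤ 1 / (2 * M) * (partialNorm Φ j x - 64 * Z * S * M * ‖Φ x‖) ^ 2 := by positivity
    show 64 * Z * S * (‖Φ x‖ * partialNorm Φ j x) ≤ _
    linarith
  rw [integral_const_mul, integral_add ((hp j).const_mul _) (hn.const_mul _), integral_const_mul,
    integral_const_mul] at h2
  have h3 := mul_le_mul_of_nonneg_left h1 (by positivity : 0 ≤ 16 * Z)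
  have h4 : 1 / M * ∫ x, partialNorm Φ j x ^ 2 = 1 / (2 * M) * (∫ x, partialNorm Φ j x ^ 2) +
      1 / (2 * M) * ∫ x, partialNorm Φ j x ^ 2 := by
    field_simp
    ring
  linarith

theorem partialNorm_const_smul {Φ : (ι → ℝ) → ℂ} (hΦ : TestFunction Φ) (r : ℝ) (j : ι)
    (x : ι → ℝ) : partialNorm (fun x => r • Φ x) j x = |r| * partialNorm Φ j x := by
  unfold partialNorm
  rw [fderiv_fun_const_smul (hΦ.differentiable x)]
  simp

theorem energy_const_smul {Φ : (ι → ℝ) → ℂ} (hΦ : TestFunction Φ) (r : ℝ) :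
    energy Z M V W (fun x => r • Φ x) = r ^ 2 * energy Z M V W Φ := by
  rw [energy_eq_integral, energy_eq_integral, ← integral_const_mul]
  refine integral_congr_ae (Filter.Eventually.of_forall fun x => ?_)
  simp only [energyDensity, partialNorm_const_smul hΦ, mul_pow, sq_abs, norm_smul,
    Real.norm_eq_abs, ← Finset.mul_sum]
  ring

theorem BoundedPotentials.bddBelow_energies (h : BoundedPotentials V W C)
    (hV : ∀ j x, V j x ≤ 8 * (√(1 + x ^ 2))⁻¹) (hZ : 0 < Z) (hM : 0 < M) :
    BddBelow {E : ℝ | ∃ Φ : (ι → ℝ) → ℂ, ContDiff ℝ ∞ Φ ∧ HasCompactSupport Φ ∧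
      ∫ x : ι → ℝ, ‖Φ x‖ ^ 2 = 1 ∧ E = energy Z M V W Φ} := by
  -- Any truncation height gives some lower bound; S = 1 is taken.
  refine ⟨-(Fintype.card ι * ((64 * Z * 1) ^ 2 * M / 2 + 16 * Z * Real.exp (-1))), ?_⟩
  rintro E ⟨Φ, h1, h2, h3, rfl⟩
  have := h.energy_lower_bound hV hZ hM one_pos ⟨h1, h2⟩
  rw [h3] at this
  have h0 : 0 ≤ 1 / (2 * M) * ∑ j, ∫ x, partialNorm Φ j x ^ 2 :=
    mul_nonneg (by positivity)
      (Finset.sum_nonneg fun j _ => integral_nonneg fun x => sq_nonneg _)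
  linarith

/-- The variational principle for unnormalized test functions. -/
theorem BoundedPotentials.groundEnergy_mul_le (h : BoundedPotentials V W C)
    (hV : ∀ j x, V j x ≤ 8 * (√(1 + x ^ 2))⁻¹) (hZ : 0 < Z) (hM : 0 < M)
    {Φ : (ι → ℝ) → ℂ} (hΦ : TestFunction Φ) :
    groundEnergy Z M V W * ∫ x, ‖Φ x‖ ^ 2 ≤ energy Z M V W Φ := by
  have hc0 : 0 ≤ ∫ x, ‖Φ x‖ ^ 2 := integral_nonneg fun x => sq_nonneg _
  rcases hc0.eq_or_lt with hc | hc
  · have := h.energy_lower_bound hV hZ hM one_pos hΦ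
    rw [← hc] at this ⊢
    have h0 : 0 ≤ 1 / (2 * M) * ∑ j, ∫ x, partialNorm Φ j x ^ 2 :=
      mul_nonneg (by positivity)
        (Finset.sum_nonneg fun j _ => integral_nonneg fun x => sq_nonneg _)
    linarith
  · set c := ∫ x, ‖Φ x‖ ^ 2 with hcdef
    have ht := hΦ.smul (f := fun _ => (√c)⁻¹) contDiff_const
    have hr : ((√c)⁻¹) ^ 2 = c⁻¹ := by rw [inv_pow, Real.sq_sqrt hc.le]
    have hle : groundEnergy Z M V W ≤ energy Z M V W fun x => (√c)⁻¹ • Φ x := by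
      refine csInf_le (h.bddBelow_energies hV hZ hM) ⟨_, ht.contDiff, ht.hasCompactSupport, ?_, rfl⟩
      simp only [norm_smul, mul_pow, norm_inv, Real.norm_eq_abs, inv_pow, sq_abs]
      rw [integral_const_mul, ← hcdef, Real.sq_sqrt hc.le, inv_mul_cancel₀ hc.ne']
    rw [energy_const_smul hΦ, hr] at hle
    have := mul_le_mul_of_nonneg_right hle hc.le
    rwa [mul_right_comm, inv_mul_cancel₀ hc.ne', one_mul] at this

/-- There is a nonzero test function supported where the particles are apart. -/
theorem exists_testFunction_separated (ι : Type) [Fintype ι] [LinearOrder ι] :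
    ∃ Φ : (ι → ℝ) → ℂ, TestFunction Φ ∧ (0 < ∫ x, ‖Φ x‖ ^ 2) ∧
      ∀ x, Φ x ≠ 0 → ∀ j k, j ≠ k → 1 ≤ |x j - x k| := by
  -- Centres at mutual distance at least 3, with a bump in the sup-norm ball of radius 1:
  -- coordinates stay at distance at least 1.
  let c : ι → ℝ := fun i => 3 * ((Fintype.equivFin ι i : ℕ) : ℝ)
  let b : ContDiffBump c := ⟨1 / 2, 1, by norm_num, by norm_num⟩
  have ht : TestFunction fun x => ((b x : ℝ) : ℂ) :=
    ⟨Complex.ofRealCLM.contDiff.comp b.contDiff,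
      b.hasCompactSupport.comp_left (g := fun t : ℝ => (t : ℂ)) (by simp)⟩
  refine ⟨_, ht, ?_, ?_⟩
  · refine (integral_pos_iff_support_of_nonneg (fun x => sq_nonneg _) ht.integrable_normSq).2 ?_
    have : Function.support (fun x => ‖((b x : ℝ) : ℂ)‖ ^ 2) = Metric.ball c 1 := by
      rw [← b.support_eq]
      ext x
      simp
    rw [this]
    exact Metric.measure_ball_pos _ _ one_pos
  · intro x hx j k hjk
    have hx' : x ∈ Metric.ball c 1 := by
      rw [← b.support_eq]
      simpa using hx
    have hj := (abs_lt.1 ((dist_le_pi_dist x c j).trans_lt (Metric.mem_ball.1 hx')))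
    have hk := (abs_lt.1 ((dist_le_pi_dist x c k).trans_lt (Metric.mem_ball.1 hx')))
    have hne : (Fintype.equivFin ι j : ℕ) ≠ (Fintype.equivFin ι k : ℕ) := fun h =>
      hjk ((Fintype.equivFin ι).injective (Fin.ext h))
    simp only [c] at hj hk
    rcases Nat.lt_or_gt_of_ne hne with hlt | hlt
    · have : ((Fintype.equivFin ι j : ℕ) : ℝ) + 1 ≤ (Fintype.equivFin ι k : ℕ) := by
        exact_mod_cast hlt
      exact le_trans (by linarith) (neg_le_abs _)
    · have : ((Fintype.equivFin ι k : ℕ) : ℝ) + 1 ≤ (Fintype.equivFin ι j : ℕ) := by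
        exact_mod_cast hlt
      exact le_trans (by linarith) (le_abs_self _)

theorem TestFunction.comp_smul {Φ : (ι → ℝ) → ℂ} (hΦ : TestFunction Φ) {r : ℝ} (hr : r ≠ 0) :
    TestFunction fun x => Φ (r • x) :=
  ⟨hΦ.contDiff.comp (contDiff_const_smul r), hΦ.hasCompactSupport.comp_smul hr⟩

theorem partialNorm_comp_smul (Φ : (ι → ℝ) → ℂ) (r : ℝ) (j : ι)
    (x : ι → ℝ) : partialNorm (fun x => Φ (r • x)) j x = |r| * partialNorm Φ j (r • x) := by
  unfold partialNorm
  rw [fderiv_comp_smul]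
  simp

/-- If the repulsion decays, particles can be spread out at no cost in energy. -/
theorem BoundedPotentials.groundEnergy_nonpos (h : BoundedPotentials V W C)
    (hV : ∀ j x, V j x ≤ 8 * (√(1 + x ^ 2))⁻¹) (hW : ∀ j k x, j < k → x ≠ 0 → W j k x ≤ |x|⁻¹)
    (hZ : 0 < Z) (hM : 0 < M) : groundEnergy Z M V W ≤ 0 := by
  obtain ⟨Φ, hΦ, hpos, hsep⟩ := exists_testFunction_separated ι
  set I := ∫ x, ‖Φ x‖ ^ 2 with hI
  set K := ∑ j, ∫ x, partialNorm Φ j x ^ 2 with hK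
  set n : ℝ := (Fintype.card ι : ℝ) with hn
  -- Dilating by 1/r multiplies the kinetic energy by r² and makes each pair repulsion at most r;
  -- the attraction only lowers the energy. Then r tends to 0.
  have hr : ∀ r : ℝ, 0 < r → groundEnergy Z M V W * I ≤ 1 / M * r ^ 2 * K + n ^ 2 * r * I := by
    intro r hr
    have ht := hΦ.comp_smul hr.ne'
    have h1 := h.groundEnergy_mul_le hV hZ hM ht
    set s := |(r ^ Module.finrank ℝ (ι → ℝ))⁻¹| with hs
    have hs0 : 0 < s := abs_pos.2 (inv_ne_zero (pow_ne_zero _ hr.ne'))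
    have hscale : ∀ f : (ι → ℝ) → ℝ, ∫ x, f (r • x) = s * ∫ x, f x := fun f => by
      rw [Measure.integral_comp_smul, smul_eq_mul]
    have hpt : ∀ x, energyDensity Z M V W (fun x => Φ (r • x)) x ≤
        ∑ j, (1 / M * r ^ 2) * partialNorm Φ j (r • x) ^ 2 + n ^ 2 * r * ‖Φ (r • x)‖ ^ 2 := by
      intro x
      unfold energyDensity
      refine add_le_add (le_of_eq ?_) ?_
      · simp only [partialNorm_comp_smul, mul_pow, sq_abs, Finset.mul_sum]
        exact Finset.sum_congr rfl fun j _ => by ring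
      · rcases eq_or_ne (Φ (r • x)) 0 with h0 | h0
        · simp [h0]
        · refine mul_le_mul_of_nonneg_right ?_ (sq_nonneg _)
          have hVs : 0 ≤ Z * ∑ j, V j (x j) :=
            mul_nonneg hZ.le (Finset.sum_nonneg fun j _ => h.V_nonneg _ _)
          have hWs : ∑ j, ∑ k, (if j < k then W j k (x j - x k) else 0) ≤
              ∑ _j : ι, ∑ _k : ι, r := by
            refine Finset.sum_le_sum fun j _ => Finset.sum_le_sum fun k _ => ?_
            split_ifs with hjk
            · have h2 := hsep _ h0 j k hjk.ne
              simp only [Pi.smul_apply, smul_eq_mul, ← mul_sub, abs_mul, abs_of_pos hr] at h2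
              have h3 : 0 < |x j - x k| := by
                by_contra hcon
                have : |x j - x k| = 0 := le_antisymm (not_lt.1 hcon) (abs_nonneg _)
                rw [this] at h2
                norm_num at h2
              refine (hW j k _ hjk (abs_pos.1 h3)).trans ?_
              rw [inv_le_iff_one_le_mul₀ h3]
              exact h2
            · exact hr.le
          have hcs : ∑ _j : ι, ∑ _k : ι, r = n ^ 2 * r := by
            simp [hn]
            ring
          unfold potential
          linarith
    have hint1 : ∀ j, Integrable fun x => (1 / M * r ^ 2) * partialNorm Φ j (r • x) ^ 2 := fun j =>
      (((hΦ.integrable_partialNormSq j).comp_smul hr.ne')).const_mul _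
    have hint2 : Integrable fun x => n ^ 2 * r * ‖Φ (r • x)‖ ^ 2 :=
      (hΦ.integrable_normSq.comp_smul hr.ne').const_mul _
    have h2 : energy Z M V W (fun x => Φ (r • x)) ≤
        1 / M * r ^ 2 * (s * K) + n ^ 2 * r * (s * I) := by
      have hint : Integrable fun x => ∑ j, (1 / M * r ^ 2) * partialNorm Φ j (r • x) ^ 2 +
          n ^ 2 * r * ‖Φ (r • x)‖ ^ 2 := (integrable_finsetSum _ fun j _ => hint1 j).add hint2
      rw [energy_eq_integral]
      refine (integral_mono (h.integrable_energyDensity Z M ht) hint hpt).trans (le_of_eq ?_)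
      rw [integral_add (integrable_finsetSum _ fun j _ => hint1 j) hint2,
        integral_finsetSum _ fun j _ => hint1 j, integral_const_mul,
        hscale fun x => ‖Φ x‖ ^ 2, hK, Finset.mul_sum, Finset.mul_sum]
      congr 1
      refine Finset.sum_congr rfl fun j _ => ?_
      rw [integral_const_mul, hscale fun x => partialNorm Φ j x ^ 2]
    rw [hscale fun x => ‖Φ x‖ ^ 2] at h1
    have h3 : s * (groundEnergy Z M V W * I) ≤ s * (1 / M * r ^ 2 * K + n ^ 2 * r * I) := by
      linarith
    exact le_of_mul_le_mul_left h3 hs0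
  have hlim : Filter.Tendsto (fun r : ℝ => 1 / M * r ^ 2 * K + n ^ 2 * r * I)
      (nhdsWithin 0 (Set.Ioi 0)) (nhds 0) := by
    have : Continuous fun r : ℝ => 1 / M * r ^ 2 * K + n ^ 2 * r * I := by fun_prop
    have := (this.tendsto 0).mono_left (nhdsWithin_le_nhds (s := Set.Ioi 0))
    simpa using this
  have hEI : groundEnergy Z M V W * I ≤ 0 :=
    ge_of_tendsto hlim (eventually_nhdsWithin_of_forall fun r hr' => hr r hr')
  by_contra hcon
  exact absurd hEI (not_le.2 (mul_pos (not_le.1 hcon) hpos))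

/-- Near minimizers exist. -/
theorem exists_energy_lt {δ : ℝ} (hδ : 0 < δ) :
    ∃ Φ : (ι → ℝ) → ℂ, TestFunction Φ ∧ ∫ x, ‖Φ x‖ ^ 2 = 1 ∧
      energy Z M V W Φ < groundEnergy Z M V W + δ := by
  obtain ⟨Φ, hΦ, hpos, -⟩ := exists_testFunction_separated ι
  have ht := hΦ.smul (f := fun _ => (√(∫ x, ‖Φ x‖ ^ 2))⁻¹) contDiff_const
  have hnorm : ∫ x, ‖(√(∫ x, ‖Φ x‖ ^ 2))⁻¹ • Φ x‖ ^ 2 = 1 := by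
    simp only [norm_smul, mul_pow, norm_inv, Real.norm_eq_abs, inv_pow, sq_abs]
    rw [integral_const_mul, Real.sq_sqrt hpos.le, inv_mul_cancel₀ hpos.ne']
  have hne : {E : ℝ | ∃ Φ : (ι → ℝ) → ℂ, ContDiff ℝ ∞ Φ ∧ HasCompactSupport Φ ∧
      ∫ x : ι → ℝ, ‖Φ x‖ ^ 2 = 1 ∧ E = energy Z M V W Φ}.Nonempty :=
    ⟨_, _, ht.contDiff, ht.hasCompactSupport, hnorm, rfl⟩
  obtain ⟨E, ⟨Ψ, h1, h2, h3, rfl⟩, hlt⟩ :=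
    exists_lt_of_csInf_lt hne (lt_add_of_pos_right (groundEnergy Z M V W) hδ)
  exact ⟨Ψ, ⟨h1, h2⟩, h3, hlt⟩

end Abstract

-- Freezing one coordinate

section Abstract

variable {ι : Type} [Fintype ι] [LinearOrder ι]
variable {V : ι → ℝ → ℝ} {W : ι → ι → ℝ → ℝ} {C Z M S : ℝ}

/-- The configuration with coordinate `y` at `i` and the coordinates `u` elsewhere. -/
def glue (i : ι) (u : {j : ι // j ≠ i} → ℝ) (y : {j : ι // ¬ j ≠ i} → ℝ) : ι → ℝ :=
  fun j => if h : j ≠ i then u ⟨j, h⟩ else y ⟨j, h⟩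

theorem glue_apply_ne (i : ι) (u : {j : ι // j ≠ i} → ℝ) (y : {j : ι // ¬ j ≠ i} → ℝ)
    (j : {j : ι // j ≠ i}) : glue i u y j = u j := by
  simp [glue, j.2]

theorem glue_apply_self (i : ι) (u : {j : ι // j ≠ i} → ℝ) (y : {j : ι // ¬ j ≠ i} → ℝ) :
    glue i u y i = y ⟨i, by simp⟩ := by
  simp [glue]

theorem contDiff_glue (i : ι) (y : {j : ι // ¬ j ≠ i} → ℝ) :
    ContDiff ℝ ∞ fun u => glue i u y := by
  refine contDiff_pi.2 fun j => ?_
  unfold glue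
  split_ifs with h
  · exact contDiff_apply ℝ ℝ _
  · exact contDiff_const

/-- Restriction to the other coordinates is a continuous left inverse. Closedness is what makes
slices of compactly supported functions compactly supported. -/
theorem isClosedEmbedding_glue (i : ι) (y : {j : ι // ¬ j ≠ i} → ℝ) :
    Topology.IsClosedEmbedding fun u => glue i u y := by
  have hl : Function.LeftInverse (fun (x : ι → ℝ) (j : {j : ι // j ≠ i}) => x j)
      (fun u => glue i u y) := fun u => funext fun j => glue_apply_ne i u y j
  exact hl.isClosedEmbedding (by fun_prop) (contDiff_glue i y).continuous

theorem TestFunction.slice {Φ : (ι → ℝ) → ℂ} (hΦ : TestFunction Φ) (i : ι)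
    (y : {j : ι // ¬ j ≠ i} → ℝ) : TestFunction fun u => Φ (glue i u y) :=
  ⟨hΦ.contDiff.comp (contDiff_glue i y),
    hΦ.hasCompactSupport.comp_isClosedEmbedding (isClosedEmbedding_glue i y)⟩

/-- The decidability instance is left arbitrary so that the lemma applies to whichever one
`partialNorm` carries on the subtype. -/
theorem glue_add_smul_single (i : ι) {_ : DecidableEq {j : ι // j ≠ i}} (u : {j : ι // j ≠ i} → ℝ) (y : {j : ι // ¬ j ≠ i} → ℝ)
    (j : {j : ι // j ≠ i}) (t : ℝ) :
    glue i (u + t • Pi.single j 1) y = glue i u y + t • Pi.single (j : ι) 1 := by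
  funext k
  by_cases hk : k ≠ i
  · have h1 := glue_apply_ne i (u + t • Pi.single j 1) y ⟨k, hk⟩
    have h2 := glue_apply_ne i u y ⟨k, hk⟩
    simp only at h1 h2
    simp only [Pi.add_apply, Pi.smul_apply, h1, h2, Pi.single_apply, Subtype.ext_iff]
  · obtain rfl := not_not.1 hk
    have : (Pi.single (j : ι) (1 : ℝ) : ι → ℝ) k = 0 := by
      rw [Pi.single_apply, if_neg (Ne.symm j.2)]
    simp [glue_apply_self, this]

theorem partialNorm_slice {Φ : (ι → ℝ) → ℂ} (hΦ : TestFunction Φ) (i : ι)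
    (u : {j : ι // j ≠ i} → ℝ) (y : {j : ι // ¬ j ≠ i} → ℝ) (j : {j : ι // j ≠ i}) :
    partialNorm (fun u => Φ (glue i u y)) j u = partialNorm Φ (j : ι) (glue i u y) := by
  unfold partialNorm
  rw [← (hΦ.differentiable _).lineDeriv_eq_fderiv,
    ← ((hΦ.slice i y).differentiable _).lineDeriv_eq_fderiv]
  simp only [lineDeriv, glue_add_smul_single]

/-- Fubini's theorem. The equivalence splits the index set by the predicate `j ≠ i`, which is why
the frozen coordinate is indexed by the one-point type `¬ j ≠ i`. -/
theorem integral_eq_integral_glue (i : ι) {F : (ι → ℝ) → ℝ} (hF : Integrable F) :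
    ∫ x, F x = ∫ y : {j : ι // ¬ j ≠ i} → ℝ, ∫ u : {j : ι // j ≠ i} → ℝ, F (glue i u y) := by
  have hmp := (volume_preserving_piEquivPiSubtypeProd (fun _ : ι => ℝ) (fun j => j ≠ i)).symm
  rw [← hmp.integral_comp' F]
  exact integral_prod_symm _ (hmp.integrable_comp_of_integrable hF)

/-- The energy density of the particles other than `i`. -/
noncomputable def energyDensityOmit (i : ι) (Z M : ℝ) (V : ι → ℝ → ℝ) (W : ι → ι → ℝ → ℝ)
    (Φ : (ι → ℝ) → ℂ) (x : ι → ℝ) : ℝ :=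
  (1 / M) * ∑ j : {j : ι // j ≠ i}, partialNorm Φ j x ^ 2 +
    potential (ι := {j : ι // j ≠ i}) Z (fun j => V j) (fun j k => W j k) (fun j => x j) *
      ‖Φ x‖ ^ 2

theorem BoundedPotentials.restrict (h : BoundedPotentials V W C) (i : ι) :
    BoundedPotentials (ι := {j : ι // j ≠ i}) (fun j => V j) (fun j k => W j k) C where
  measurable_V j := h.measurable_V j
  measurable_W j k := h.measurable_W j k
  V_nonneg j := h.V_nonneg j
  V_le j := h.V_le j
  W_nonneg j k := h.W_nonneg j k
  W_le j k x hjk := h.W_le j k x hjk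

theorem BoundedPotentials.integrable_mul_energyDensityOmit (h : BoundedPotentials V W C)
    {Φ : (ι → ℝ) → ℂ} (hΦ : TestFunction Φ) (i : ι) {f : (ι → ℝ) → ℝ} {D : ℝ}
    (hf : Measurable f) (hD : ∀ x, |f x| ≤ D) :
    Integrable fun x => f x * energyDensityOmit i Z M V W Φ x := by
  obtain ⟨D', hD'⟩ := (h.restrict i).exists_abs_potential_le Z
  have h1 : Integrable (fun x => ∑ j : {j : ι // j ≠ i}, f x * partialNorm Φ j x ^ 2) :=
    integrable_finsetSum _ fun j _ => hΦ.integrable_mul_partialNormSq j hf hD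
  have hmeas : Measurable fun x : ι → ℝ => potential (ι := {j : ι // j ≠ i}) Z (fun j => V j)
      (fun j k => W j k) (fun j => x j) :=
    ((h.restrict i).measurable_potential Z).comp (by fun_prop)
  have h2 := hΦ.integrable_mul_normSq (hf.mul hmeas) (C := D * D') fun x => by
      rw [Pi.mul_apply, abs_mul]
      exact mul_le_mul (hD x) (hD' _) (abs_nonneg _) ((abs_nonneg _).trans (hD x))
  refine ((h1.const_mul (1 / M)).add h2).congr (Filter.Eventually.of_forall fun x => ?_)
  simp only [energyDensityOmit, Pi.add_apply, Pi.mul_apply, ← Finset.mul_sum]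
  ring

/-- Integrating the variational principle for the other particles over the coordinate `x_i`. -/
theorem BoundedPotentials.groundEnergy_omit_mul_le (h : BoundedPotentials V W C)
    (hV : ∀ j x, V j x ≤ 8 * (√(1 + x ^ 2))⁻¹) (hZ : 0 < Z) (hM : 0 < M)
    {Φ : (ι → ℝ) → ℂ} (hΦ : TestFunction Φ) (i : ι) {g : ℝ → ℝ} {D : ℝ} (hg : Measurable g)
    (hg0 : ∀ t, 0 ≤ g t) (hgD : ∀ t, g t ≤ D) :
    groundEnergy (ι := {j : ι // j ≠ i}) Z M (fun j => V j) (fun j k => W j k) *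
      ∫ x, g (x i) * ‖Φ x‖ ^ 2 ≤ ∫ x, g (x i) * energyDensityOmit i Z M V W Φ x := by
  set E := groundEnergy (ι := {j : ι // j ≠ i}) Z M (fun j => V j) (fun j k => W j k)
  have hgm : Measurable fun x : ι → ℝ => g (x i) := hg.comp (measurable_pi_apply i)
  have hgb : ∀ x : ι → ℝ, |g (x i)| ≤ D := fun x => by
    rw [abs_of_nonneg (hg0 _)]
    exact hgD _
  have h1 := hΦ.integrable_mul_normSq hgm hgb
  have h2 := h.integrable_mul_energyDensityOmit (Z := Z) (M := M) hΦ i hgm hgb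
  have h0 : Integrable fun x => g (x i) * energyDensityOmit i Z M V W Φ x -
      E * (g (x i) * ‖Φ x‖ ^ 2) := h2.sub (h1.const_mul E)
  rw [← integral_const_mul, ← sub_nonneg, ← integral_sub h2 (h1.const_mul E),
    integral_eq_integral_glue i h0]
  refine integral_nonneg fun y => ?_
  have hs := hΦ.slice i y
  have h3 := (h.restrict i).groundEnergy_mul_le (fun j => hV j) hZ hM hs
  have h4 := (h.restrict i).integrable_energyDensity Z M hs
  -- On a slice g is constant, so the integrand is g times the deficit in the variational principle
  -- for the remaining particles.
  have h5 : (fun u => g (glue i u y i) * energyDensityOmit i Z M V W Φ (glue i u y) -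
      E * (g (glue i u y i) * ‖Φ (glue i u y)‖ ^ 2)) = fun u => g (y ⟨i, by simp⟩) *
      (energyDensity (ι := {j : ι // j ≠ i}) Z M (fun j => V j) (fun j k => W j k)
        (fun u => Φ (glue i u y)) u - E * ‖Φ (glue i u y)‖ ^ 2) := by
    funext u
    have h6 : (fun j : {j : ι // j ≠ i} => glue i u y j) = u :=
      funext fun j => glue_apply_ne i u y j
    simp only [glue_apply_self, energyDensityOmit, energyDensity, partialNorm_slice hΦ, h6]
    ring
  show 0 ≤ ∫ u, (g (glue i u y i) * energyDensityOmit i Z M V W Φ (glue i u y) -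
      E * (g (glue i u y i) * ‖Φ (glue i u y)‖ ^ 2))
  rw [h5, integral_const_mul, integral_sub h4 (hs.integrable_normSq.const_mul E),
    integral_const_mul]
  exact mul_nonneg (hg0 _) (sub_nonneg.2 h3)

-- Localization of near minimizers

/-- The localization `√(1 - s G) Φ` as a competitor: a near minimizer almost satisfies the
Euler-Lagrange equation tested against `G Φ`. -/
theorem BoundedPotentials.integral_mul_energyDensity_sub_le (h : BoundedPotentials V W C)
    (hV : ∀ j x, V j x ≤ 8 * (√(1 + x ^ 2))⁻¹) (hZ : 0 < Z) (hM : 0 < M)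
    {Φ : (ι → ℝ) → ℂ} (hΦ : TestFunction Φ) (hnorm : ∫ x, ‖Φ x‖ ^ 2 = 1) {δ : ℝ}
    (hδ : energy Z M V W Φ ≤ groundEnergy Z M V W + δ) {G : (ι → ℝ) → ℝ} {D s : ℝ}
    (hG : ContDiff ℝ ∞ G) (hG0 : ∀ x, 0 ≤ G x) (hGD : ∀ x, G x ≤ D)
    (hG' : ∀ x j, |fderiv ℝ G x (Pi.single j 1)| ≤ 1) (hs : 0 < s) (hsD : s * D ≤ 1 / 2) :
    ∫ x, G x * (energyDensity Z M V W Φ x - groundEnergy Z M V W * ‖Φ x‖ ^ 2) ≤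
      δ / s + 1 / M * ∑ j, (∫ x, ‖Φ x‖ * partialNorm Φ j x) + Fintype.card ι * s / (2 * M) := by
  set E := groundEnergy Z M V W with hE
  -- Since s D ≤ 1/2, the radicand stays away from 0, so the square root is smooth and its gradient
  -- is of order s.
  have hhalf : ∀ x, 1 / 2 ≤ 1 - s * G x := fun x => by
    have := mul_le_mul_of_nonneg_left (hGD x) hs.le
    linarith
  set f : (ι → ℝ) → ℝ := fun x => √(1 - s * G x) with hf
  have hfpos : ∀ x, 0 < f x := fun x => Real.sqrt_pos.2 (by linarith [hhalf x])
  have hfsq : ∀ x, f x ^ 2 = 1 - s * G x := fun x => Real.sq_sqrt (by linarith [hhalf x])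
  have hfc : ContDiff ℝ ∞ f :=
    (contDiff_const.sub (contDiff_const.mul hG)).sqrt fun x => by linarith [hhalf x]
  have hft := hΦ.smul hfc
  have hGm : Measurable G := hG.continuous.measurable
  have hGb : ∀ x, |G x| ≤ D := fun x => by
    rw [abs_of_nonneg (hG0 _)]
    exact hGD _
  have hdf : ∀ x j, |fderiv ℝ f x (Pi.single j 1)| * (2 * f x) ≤ s := by
    intro x j
    have h1 : HasFDerivAt f ((1 / (2 * √(1 - s * G x))) • -(s • fderiv ℝ G x)) x := by
      have hGx := ((hG.differentiable (by simp) x).hasFDerivAt.const_mul s).const_sub 1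
      exact hGx.sqrt (by linarith [hhalf x])
    rw [h1.fderiv]
    have h2 : ((1 / (2 * √(1 - s * G x))) • -(s • fderiv ℝ G x)) (Pi.single j 1) =
        -(1 / (2 * f x) * (s * fderiv ℝ G x (Pi.single j 1))) := by
      simp [hf]
    have h3 := hfpos x
    rw [h2, abs_neg, abs_mul, abs_mul, abs_of_pos hs, abs_of_pos (by positivity)]
    calc _ = s * |fderiv ℝ G x (Pi.single j 1)| := by field_simp
      _ ≤ s * 1 := mul_le_mul_of_nonneg_left (hG' x j) hs.le
      _ = s := mul_one s
  -- The cross term contains 2 f |∂f|, the derivative of f² up to sign, so it is bounded by s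
  -- without dividing by f.
  have hpart : ∀ x j, partialNorm (fun x => f x • Φ x) j x ^ 2 ≤
      (1 - s * G x) * partialNorm Φ j x ^ 2 + s * (‖Φ x‖ * partialNorm Φ j x) +
        s ^ 2 / 2 * ‖Φ x‖ ^ 2 := by
    intro x j
    have h1 : partialNorm (fun x => f x • Φ x) j x ≤
        f x * partialNorm Φ j x + |fderiv ℝ f x (Pi.single j 1)| * ‖Φ x‖ := by
      unfold partialNorm
      rw [fderiv_fun_smul (hfc.differentiable (by simp) x) (hΦ.differentiable x)]
      refine (norm_add_le _ _).trans (le_of_eq ?_)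
      simp [abs_of_pos (hfpos x)]
    set d := |fderiv ℝ f x (Pi.single j 1)| with hd
    have hd0 : 0 ≤ d := abs_nonneg _
    have h2 := hdf x j
    have h3 := hfpos x
    have h4 := hfsq x
    have h5 : d ^ 2 ≤ s ^ 2 / 2 := by
      have h6 : (d * (2 * f x)) ^ 2 ≤ s ^ 2 := pow_le_pow_left₀ (by positivity) h2 2
      have h7 : d ^ 2 * 2 ≤ (d * (2 * f x)) ^ 2 := by
        rw [mul_pow, mul_pow, h4]
        exact mul_le_mul_of_nonneg_left (by linarith [hhalf x]) (sq_nonneg d)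
      linarith
    have hp := partialNorm_nonneg Φ j x
    have hn := norm_nonneg (Φ x)
    calc _ ≤ (f x * partialNorm Φ j x + d * ‖Φ x‖) ^ 2 :=
          pow_le_pow_left₀ (partialNorm_nonneg _ _ _) h1 2
      _ = f x ^ 2 * partialNorm Φ j x ^ 2 + (d * (2 * f x)) * (‖Φ x‖ * partialNorm Φ j x) +
          d ^ 2 * ‖Φ x‖ ^ 2 := by ring
      _ ≤ _ := by
        rw [h4]
        gcongr
  have i1 := h.integrable_energyDensity Z M hΦ
  have i2 := h.integrable_mul_energyDensity Z M hΦ hGm hGb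
  have i3 := hΦ.integrable_norm_mul_partialNorm
  have i4 := hΦ.integrable_normSq
  have i5 := hΦ.integrable_mul_normSq hGm hGb
  have i3s : Integrable fun x => ∑ j, ‖Φ x‖ * partialNorm Φ j x :=
    integrable_finsetSum _ fun j _ => i3 j
  set n : ℝ := (Fintype.card ι : ℝ) with hn
  have hpt : ∀ x, energyDensity Z M V W (fun x => f x • Φ x) x ≤
      energyDensity Z M V W Φ x - s * (G x * energyDensity Z M V W Φ x) +
      s / M * ∑ j, ‖Φ x‖ * partialNorm Φ j x + n * s ^ 2 / (2 * M) * ‖Φ x‖ ^ 2 := by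
    intro x
    have h1 : ∑ j, partialNorm (fun x => f x • Φ x) j x ^ 2 ≤
        ∑ j, ((1 - s * G x) * partialNorm Φ j x ^ 2 + s * (‖Φ x‖ * partialNorm Φ j x) +
          s ^ 2 / 2 * ‖Φ x‖ ^ 2) := Finset.sum_le_sum fun j _ => hpart x j
    rw [Finset.sum_add_distrib, Finset.sum_add_distrib, ← Finset.mul_sum, ← Finset.mul_sum,
      Finset.sum_const, Finset.card_univ, nsmul_eq_mul, ← hn] at h1
    have h2 := mul_le_mul_of_nonneg_left h1 (by positivity : 0 ≤ 1 / M)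
    have h3 : ‖f x • Φ x‖ ^ 2 = (1 - s * G x) * ‖Φ x‖ ^ 2 := by
      rw [norm_smul, mul_pow, Real.norm_eq_abs, sq_abs, hfsq]
    unfold energyDensity
    simp only [h3]
    refine (add_le_add_left h2 _).trans (le_of_eq ?_)
    ring
  have hi : Integrable fun x =>
      energyDensity Z M V W Φ x - s * (G x * energyDensity Z M V W Φ x) :=
    i1.sub (i2.const_mul s)
  have hi' : Integrable fun x =>
      energyDensity Z M V W Φ x - s * (G x * energyDensity Z M V W Φ x) +
      s / M * ∑ j, ‖Φ x‖ * partialNorm Φ j x := hi.add (i3s.const_mul _)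
  have hup : energy Z M V W (fun x => f x • Φ x) ≤
      energy Z M V W Φ - s * (∫ x, G x * energyDensity Z M V W Φ x) +
      s / M * ∑ j, (∫ x, ‖Φ x‖ * partialNorm Φ j x) + n * s ^ 2 / (2 * M) := by
    have hi'' : Integrable fun x =>
        energyDensity Z M V W Φ x - s * (G x * energyDensity Z M V W Φ x) +
        s / M * ∑ j, ‖Φ x‖ * partialNorm Φ j x + n * s ^ 2 / (2 * M) * ‖Φ x‖ ^ 2 :=
      hi'.add (i4.const_mul _)
    rw [energy_eq_integral]
    refine (integral_mono (h.integrable_energyDensity Z M hft) hi'' hpt).trans (le_of_eq ?_)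
    rw [integral_add hi' (i4.const_mul _), integral_add hi (i3s.const_mul _),
      integral_sub i1 (i2.const_mul s), integral_const_mul, integral_const_mul,
      integral_const_mul, integral_finsetSum _ fun j _ => i3 j, hnorm, mul_one,
      energy_eq_integral]
  have hlow := h.groundEnergy_mul_le hV hZ hM hft
  have hnorm' : ∫ x, ‖f x • Φ x‖ ^ 2 = 1 - s * ∫ x, G x * ‖Φ x‖ ^ 2 := by
    rw [← hnorm, ← integral_const_mul, ← integral_sub i4 (i5.const_mul s)]
    refine integral_congr_ae (Filter.Eventually.of_forall fun x => ?_)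
    simp only [norm_smul, mul_pow, Real.norm_eq_abs, sq_abs, hfsq]
    ring
  rw [hnorm', ← hE] at hlow
  have hsplit : ∫ x, G x * (energyDensity Z M V W Φ x - E * ‖Φ x‖ ^ 2) =
      (∫ x, G x * energyDensity Z M V W Φ x) - E * ∫ x, G x * ‖Φ x‖ ^ 2 := by
    rw [← integral_const_mul, ← integral_sub i2 (i5.const_mul E)]
    exact integral_congr_ae (Filter.Eventually.of_forall fun x => by ring)
  rw [hsplit]
  refine le_of_mul_le_mul_left ?_ hs
  have : s * (δ / s + 1 / M * ∑ j, (∫ x, ‖Φ x‖ * partialNorm Φ j x) + n * s / (2 * M)) =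
      δ + s / M * ∑ j, (∫ x, ‖Φ x‖ * partialNorm Φ j x) + n * s ^ 2 / (2 * M) := by
    field_simp
  rw [this]
  linarith

end Abstract

-- The weight

/-- A bounded smooth version of `√(t² + n)`. -/
noncomputable def weight (n l t : ℝ) : ℝ := √(t ^ 2 + n) / (1 + l * √(t ^ 2 + n))

section Weight

variable {n l : ℝ}

theorem weight_nonneg (hl : 0 < l) (t : ℝ) : 0 ≤ weight n l t := by
  unfold weight
  positivity

theorem weight_le_sqrt (hl : 0 < l) (t : ℝ) : weight n l t ≤ √(t ^ 2 + n) :=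
  div_le_self (Real.sqrt_nonneg _) (by linarith [mul_nonneg hl.le (Real.sqrt_nonneg (t ^ 2 + n))])

theorem weight_le (hl : 0 < l) (t : ℝ) : weight n l t ≤ 1 / l := by
  have := Real.sqrt_nonneg (t ^ 2 + n)
  unfold weight
  rw [div_le_div_iff₀ (by positivity) hl]
  linarith

theorem hasDerivAt_weight (hn : 0 < n) (hl : 0 < l) (t : ℝ) :
    HasDerivAt (weight n l) (t / √(t ^ 2 + n) / (1 + l * √(t ^ 2 + n)) ^ 2) t := by
  have hp : 0 < t ^ 2 + n := by positivity
  have hs := Real.sqrt_pos.2 hp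
  have h1 : HasDerivAt (fun t : ℝ => √(t ^ 2 + n)) (t / √(t ^ 2 + n)) t := by
    have := ((hasDerivAt_pow 2 t).add_const n).sqrt hp.ne'
    refine this.congr_deriv ?_
    field_simp
    simp
  have h2 := h1.div ((h1.const_mul l).const_add 1) (by positivity)
  refine h2.congr_deriv ?_
  field_simp
  ring

theorem abs_deriv_weight_le (hn : 0 < n) (hl : 0 < l) (t : ℝ) :
    |t / √(t ^ 2 + n) / (1 + l * √(t ^ 2 + n)) ^ 2| ≤ 1 := by
  have hp : 0 < t ^ 2 + n := by positivity
  have hs := Real.sqrt_pos.2 hp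
  rw [abs_div, abs_div, abs_of_pos hs, abs_of_pos (by positivity : 0 < (1 + l * √(t ^ 2 + n)) ^ 2)]
  refine div_le_one_of_le₀ ?_ (by positivity)
  calc |t| / √(t ^ 2 + n) ≤ 1 :=
        div_le_one_of_le₀ (Real.abs_le_sqrt (by linarith)) hs.le
    _ ≤ (1 + l * √(t ^ 2 + n)) ^ 2 := one_le_pow₀ (by linarith [mul_pos hl hs])

theorem contDiff_weight (hn : 0 < n) (hl : 0 < l) : ContDiff ℝ ∞ (weight n l) := by
  have h1 : ContDiff ℝ ∞ fun t : ℝ => √(t ^ 2 + n) :=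
    ((contDiff_id.pow 2).add contDiff_const).sqrt fun t => by
      have : 0 < t ^ 2 + n := by positivity
      exact this.ne'
  exact h1.div (contDiff_const.add (contDiff_const.mul h1)) fun t => by positivity

/-- In the range where l √(t² + n) ≤ 1/2 the denominator is at most 3/2, so the truncation loses
only a factor 2/3. -/
theorem two_thirds_le_weight {K t : ℝ} (hl : 0 < l) (hlK : l * K ≤ 1 / 2)
    (ht : √(t ^ 2 + n) ≤ K) : 2 / 3 * √(t ^ 2 + n) ≤ weight n l t := by
  have hs := Real.sqrt_nonneg (t ^ 2 + n)
  have h1 : l * √(t ^ 2 + n) ≤ 1 / 2 := (mul_le_mul_of_nonneg_left ht hl.le).trans hlK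
  unfold weight
  rw [le_div_iff₀ (by positivity)]
  nlinarith

/-- The map r ↦ r/(1 + l r) is increasing, and its value at r = K is at least 2K/3. -/
theorem le_weight_of_le {K t : ℝ} (hl : 0 < l) (hlK : l * K ≤ 1 / 2)
    (ht : K ≤ √(t ^ 2 + n)) : 2 / 3 * K ≤ weight n l t := by
  have hs := Real.sqrt_nonneg (t ^ 2 + n)
  unfold weight
  rw [le_div_iff₀ (by positivity)]
  nlinarith

/-- Triangle inequality in the plane for the vectors (t, √n) and (u, -√n), whose difference is (t -
u, 2√n). -/
theorem sqrt_sub_sq_le (hn : 0 ≤ n) (t u : ℝ) :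
    √((t - u) ^ 2 + 4 * n) ≤ √(t ^ 2 + n) + √(u ^ 2 + n) := by
  have ht := Real.sqrt_nonneg (t ^ 2 + n)
  have hu := Real.sqrt_nonneg (u ^ 2 + n)
  have ht2 := Real.sq_sqrt (by positivity : 0 ≤ t ^ 2 + n)
  have hu2 := Real.sq_sqrt (by positivity : 0 ≤ u ^ 2 + n)
  refine Real.sqrt_le_iff.2 ⟨by positivity, ?_⟩
  have h1 : n - t * u ≤ √(t ^ 2 + n) * √(u ^ 2 + n) := by
    rw [← Real.sqrt_mul (by positivity)]
    refine Real.le_sqrt_of_sq_le ?_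
    nlinarith [mul_nonneg hn (sq_nonneg (t + u))]
  nlinarith

end Weight

-- Binding and repulsion against attraction and localization error

section Abstract

variable {ι : Type} [Fintype ι] [LinearOrder ι]
variable {V : ι → ℝ → ℝ} {W : ι → ι → ℝ → ℝ} {C Z M S : ℝ}

theorem sum_subtype_ne (i : ι) (f : ι → ℝ) :
    ∑ j : {j : ι // j ≠ i}, f j = ∑ j, if j = i then 0 else f j := by
  rw [← Finset.sum_subtype (Finset.univ.filter fun j => j ≠ i) (by simp) f, Finset.sum_filter]
  exact Finset.sum_congr rfl fun j _ => by by_cases h : j = i <;> simp [h]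

/-- Weighted sum of the parts of the potential that involve each of the particles. -/
theorem sum_mul_potential_sub (Z : ℝ) (V : ι → ℝ → ℝ) (W : ι → ι → ℝ → ℝ) (w x : ι → ℝ) :
    ∑ i, w i * (potential Z V W x - potential (ι := {j : ι // j ≠ i}) Z (fun j => V j)
      (fun j k => W j k) (fun j => x j)) =
    -Z * ∑ i, w i * V i (x i) +
      ∑ j, ∑ k, if j < k then W j k (x j - x k) * (w j + w k) else 0 := by
  set a : ι → ι → ℝ := fun j k => if j < k then W j k (x j - x k) else 0 with ha
  have h1 : ∀ i, potential Z V W x - potential (ι := {j : ι // j ≠ i}) Z (fun j => V j)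
      (fun j k => W j k) (fun j => x j) = -Z * V i (x i) +
      ∑ j, ∑ k, (a j k - if j = i then 0 else if k = i then 0 else a j k) := by
    intro i
    have h2 : ∑ j : {j : ι // j ≠ i}, V j (x j) = ∑ j, V j (x j) - V i (x i) := by
      have h3 : ∑ j, V j (x j) =
          ∑ j, ((if j = i then 0 else V j (x j)) + if j = i then V j (x j) else 0) :=
        Finset.sum_congr rfl fun j _ => by by_cases h : j = i <;> simp [h]
      rw [sum_subtype_ne i fun j => V j (x j), h3, Finset.sum_add_distrib,
        Finset.sum_ite_eq' Finset.univ i]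
      simp
    have h3 : ∑ j : {j : ι // j ≠ i}, ∑ k : {j : ι // j ≠ i},
        (if j < k then W j k (x j - x k) else 0) =
        ∑ j, ∑ k, if j = i then 0 else if k = i then 0 else a j k := by
      have h4 : ∀ j : {j : ι // j ≠ i}, ∑ k : {j : ι // j ≠ i},
          (if j < k then W j k (x j - x k) else 0) = ∑ k, if k = i then 0 else a j k := by
        intro j
        rw [← sum_subtype_ne i fun k => a j k]
        exact Finset.sum_congr rfl fun k _ => by simp only [ha, Subtype.coe_lt_coe]
      rw [Finset.sum_congr rfl fun j _ => h4 j,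
        sum_subtype_ne i fun j => ∑ k, if k = i then 0 else a j k]
      exact Finset.sum_congr rfl fun j _ => by by_cases h : j = i <;> simp [h]
    unfold potential
    rw [h2, h3]
    simp only [Finset.sum_sub_distrib, ha]
    ring
  simp only [h1, mul_add, Finset.sum_add_distrib]
  congr 1
  · rw [Finset.mul_sum]
    exact Finset.sum_congr rfl fun i _ => by ring
  · simp only [Finset.mul_sum]
    rw [Finset.sum_comm]
    refine Finset.sum_congr rfl fun j _ => ?_
    rw [Finset.sum_comm]
    refine Finset.sum_congr rfl fun k _ => ?_
    -- A pair is lost on removing particle i exactly when i is one of its two members, so it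
    -- collects the weights of both.
    by_cases hjk : j < k
    · have h5 : ∀ i, w i * (a j k - if j = i then 0 else if k = i then 0 else a j k) =
          (if j = i then w i * a j k else 0) + (if k = i then w i * a j k else 0) := by
        intro i
        by_cases h6 : j = i
        · have h7 : ¬ k = i := fun h => (h6.trans h.symm ▸ hjk).ne rfl
          simp [h6, h7]
        · by_cases h7 : k = i <;> simp [h6, h7]
      simp only [h5, Finset.sum_add_distrib, Finset.sum_ite_eq, Finset.mem_univ, if_true]
      simp only [ha, hjk, if_true]
      ring
    · simp [ha, hjk]

theorem sum_sum_ite_lt (c : ℝ) : ∑ j : ι, ∑ k : ι, (if j < k then c else 0) =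
    Fintype.card ι * (Fintype.card ι - 1) / 2 * c := by
  have h1 : ∑ j : ι, ∑ k : ι, (if j < k then c else 0) =
      ∑ j : ι, ∑ k : ι, (if k < j then c else 0) := Finset.sum_comm
  have h2 : ∑ j : ι, ∑ k : ι, ((if j < k then c else 0) + (if k < j then c else 0)) =
      ∑ j : ι, ∑ k : ι, (c - if j = k then c else 0) := by
    refine Finset.sum_congr rfl fun j _ => Finset.sum_congr rfl fun k _ => ?_
    rcases lt_trichotomy j k with h | h | h
    · simp [h, h.ne, h.not_gt]
    · simp [h]
    · simp [h, h.ne', h.not_gt]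
  simp only [Finset.sum_add_distrib, Finset.sum_sub_distrib, Finset.sum_ite_eq, Finset.mem_univ,
    if_true, Finset.sum_const, Finset.card_univ, nsmul_eq_mul, ← h1] at h2
  linarith

/-- The repulsion, or else the binding energy, dominates: lower bound for the weighted sum of
the binding energies and the repulsion. -/
theorem le_sum_weight_add_repulsion (hWnn : ∀ j k x, 0 ≤ W j k x) {n l κ : ℝ}
    (hn : n = Fintype.card ι)
    (hn1 : 1 ≤ n) (hW : ∀ j k x, j < k → (√(x ^ 2 + 4 * n))⁻¹ ≤ W j k x) (hκ : 0 < κ)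
    (hl : l = κ / (4 * n ^ 2)) (x : ι → ℝ) :
    n * (n - 1) / 3 ≤ κ * ∑ i, weight n l (x i) +
      ∑ j, ∑ k, if j < k then W j k (x j - x k) * (weight n l (x j) + weight n l (x k)) else 0 := by
  have hl0 : 0 < l := by rw [hl]; positivity
  have hw := weight_nonneg (n := n) hl0
  have hlK : l * (2 * n ^ 2 / κ) ≤ 1 / 2 := by
    rw [hl]
    apply le_of_eq
    field_simp
    norm_num
  -- The threshold K = 2n²/κ satisfies l K = 1/2. A particle beyond it has weight at least 2K/3, and
  -- its binding energy κ w ≥ 4n²/3 suffices alone. Otherwise every weight is in its nearly linear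
  -- range and each of the n(n-1)/2 pairs contributes at least 2/3.
  by_cases hx : ∃ i, 2 * n ^ 2 / κ ≤ √(x i ^ 2 + n)
  · obtain ⟨i, hi⟩ := hx
    have h1 := le_weight_of_le hl0 hlK hi
    have h2 : weight n l (x i) ≤ ∑ i, weight n l (x i) :=
      Finset.single_le_sum (f := fun i => weight n l (x i)) (fun i _ => hw (x i))
        (Finset.mem_univ i)
    have h3 : 0 ≤ ∑ j, ∑ k, if j < k then W j k (x j - x k) *
        (weight n l (x j) + weight n l (x k)) else 0 :=
      Finset.sum_nonneg fun j _ => Finset.sum_nonneg fun k _ => by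
        split_ifs
        · exact mul_nonneg (hWnn _ _ _) (add_nonneg (hw _) (hw _))
        · exact le_rfl
    have h4 := mul_le_mul_of_nonneg_left (h1.trans h2) hκ.le
    have h5 : κ * (2 / 3 * (2 * n ^ 2 / κ)) = 4 / 3 * n ^ 2 := by field_simp; norm_num
    nlinarith
  · push Not at hx
    have h1 : ∑ j : ι, ∑ k : ι, (if j < k then (2 / 3 : ℝ) else 0) ≤
        ∑ j, ∑ k, if j < k then W j k (x j - x k) *
        (weight n l (x j) + weight n l (x k)) else 0 := by
      refine Finset.sum_le_sum fun j _ => Finset.sum_le_sum fun k _ => ?_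
      split_ifs with hjk
      · have h2 := two_thirds_le_weight hl0 hlK (hx j).le
        have h3 := two_thirds_le_weight hl0 hlK (hx k).le
        have h4 := sqrt_sub_sq_le (by linarith : 0 ≤ n) (x j) (x k)
        have h5 : 0 < √((x j - x k) ^ 2 + 4 * n) := Real.sqrt_pos.2 (by positivity)
        calc (2 / 3 : ℝ) = (√((x j - x k) ^ 2 + 4 * n))⁻¹ *
              (2 / 3 * √((x j - x k) ^ 2 + 4 * n)) := by field_simp
          _ ≤ _ := mul_le_mul (hW j k _ hjk) (by linarith) (by positivity) (hWnn _ _ _)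
      · exact le_rfl
    rw [sum_sum_ite_lt, ← hn] at h1
    have h6 : 0 ≤ κ * ∑ i, weight n l (x i) :=
      mul_nonneg hκ.le (Finset.sum_nonneg fun i _ => hw (x i))
    linarith

/-- Each coordinate occurs in a single summand, so the bound on the partial derivatives does not
grow with the number of particles. -/
theorem fderiv_sum_weight {n l : ℝ} (hn : 0 < n) (hl : 0 < l) (x : ι → ℝ) (j : ι) :
    |fderiv ℝ (fun x : ι → ℝ => ∑ i, weight n l (x i)) x (Pi.single j 1)| ≤ 1 := by
  have h1 : HasFDerivAt (fun x : ι → ℝ => ∑ i, weight n l (x i))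
      (∑ i, (x i / √(x i ^ 2 + n) / (1 + l * √(x i ^ 2 + n)) ^ 2) •
        ContinuousLinearMap.proj (R := ℝ) (φ := fun _ : ι => ℝ) i) x :=
    HasFDerivAt.fun_sum fun i _ =>
      HasDerivAt.comp_hasFDerivAt (h₂ := weight n l) (f := fun x : ι → ℝ => x i) x
      (hasDerivAt_weight hn hl (x i))
      (ContinuousLinearMap.proj (R := ℝ) (φ := fun _ : ι => ℝ) i).hasFDerivAt
  rw [h1.fderiv]
  have h2 : (∑ i, (x i / √(x i ^ 2 + n) / (1 + l * √(x i ^ 2 + n)) ^ 2) •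
        ContinuousLinearMap.proj (R := ℝ) (φ := fun _ : ι => ℝ) i) (Pi.single j (1 : ℝ)) =
      x j / √(x j ^ 2 + n) / (1 + l * √(x j ^ 2 + n)) ^ 2 := by
    simp [Pi.single_apply]
  rw [h2]
  exact abs_deriv_weight_le hn hl (x j)

/-- If all particles are bound, the energy weighted with the distances is bounded below by the
mutual repulsion. -/
theorem BoundedPotentials.le_integral_sum_weight_mul (h : BoundedPotentials V W C) {n κ l : ℝ}
    (hn : n = Fintype.card ι) (hn1 : 1 ≤ n)
    (hV : ∀ j x, V j x ≤ 8 * (√(x ^ 2 + n))⁻¹)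
    (hV' : ∀ j x, V j x ≤ 8 * (√(1 + x ^ 2))⁻¹)
    (hW : ∀ j k x, j < k → (√(x ^ 2 + 4 * n))⁻¹ ≤ W j k x)
    (hZ : 0 < Z) (hM : 0 < M) (hκ : 0 < κ) (hl : l = κ / (4 * n ^ 2))
    (hbind : ∀ i, groundEnergy Z M V W + κ ≤
      groundEnergy (ι := {j : ι // j ≠ i}) Z M (fun j => V j) (fun j k => W j k))
    {Φ : (ι → ℝ) → ℂ} (hΦ : TestFunction Φ) (hnorm : ∫ x, ‖Φ x‖ ^ 2 = 1) :
    n * (n - 1) / 3 - 8 * Z * n ≤ ∫ x, (∑ i, weight n l (x i)) *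
      (energyDensity Z M V W Φ x - groundEnergy Z M V W * ‖Φ x‖ ^ 2) := by
  set E := groundEnergy Z M V W with hE
  have hl0 : 0 < l := by rw [hl]; positivity
  have hw := weight_nonneg (n := n) hl0
  have hwc := contDiff_weight (by linarith : 0 < n) hl0
  have hwm : ∀ i, Measurable fun x : ι → ℝ => weight n l (x i) := fun i =>
    hwc.continuous.measurable.comp (measurable_pi_apply i)
  have hwb : ∀ i, ∀ x : ι → ℝ, |weight n l (x i)| ≤ 1 / l := fun i x => by
    rw [abs_of_nonneg (hw _)]
    exact weight_le hl0 _
  have i1 := fun i => h.integrable_mul_energyDensity Z M hΦ (hwm i) (hwb i)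
  have i2 := fun i => hΦ.integrable_mul_normSq (hwm i) (hwb i)
  have i3 := fun i => h.integrable_mul_energyDensityOmit (Z := Z) (M := M) hΦ i (hwm i) (hwb i)
  have i4 : ∀ i, Integrable fun x : ι → ℝ => weight n l (x i) * energyDensity Z M V W Φ x -
      E * (weight n l (x i) * ‖Φ x‖ ^ 2) := fun i => (i1 i).sub ((i2 i).const_mul E)
  have i5 : ∀ i, Integrable fun x : ι → ℝ => weight n l (x i) * energyDensity Z M V W Φ x -
      weight n l (x i) * energyDensityOmit i Z M V W Φ x := fun i => (i1 i).sub (i3 i)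
  have i6 : ∀ i, Integrable fun x : ι → ℝ => weight n l (x i) * energyDensity Z M V W Φ x -
      weight n l (x i) * energyDensityOmit i Z M V W Φ x + κ * (weight n l (x i) * ‖Φ x‖ ^ 2) :=
    fun i => (i5 i).add ((i2 i).const_mul κ)
  have hrhs : ∫ x, (∑ i, weight n l (x i)) * (energyDensity Z M V W Φ x - E * ‖Φ x‖ ^ 2) =
      ∑ i, ∫ x, (weight n l (x i) * energyDensity Z M V W Φ x -
        E * (weight n l (x i) * ‖Φ x‖ ^ 2)) := by
    rw [← integral_finsetSum _ fun i _ => i4 i]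
    refine integral_congr_ae (Filter.Eventually.of_forall fun x => ?_)
    simp only [Finset.sum_mul]
    exact Finset.sum_congr rfl fun i _ => by ring
  rw [hrhs]
  -- Binding gives E ≤ E_i - κ for the energy E_i without particle i, and E_i is then replaced by
  -- the energy of the other particles in the state Φ.
  have hterm : ∀ i, ∫ x, (weight n l (x i) * energyDensity Z M V W Φ x -
      weight n l (x i) * energyDensityOmit i Z M V W Φ x + κ * (weight n l (x i) * ‖Φ x‖ ^ 2)) ≤
      ∫ x, (weight n l (x i) * energyDensity Z M V W Φ x -
        E * (weight n l (x i) * ‖Φ x‖ ^ 2)) := by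
    intro i
    have h1 := h.groundEnergy_omit_mul_le hV' hZ hM hΦ i hwc.continuous.measurable hw
      (weight_le hl0)
    have h2 : 0 ≤ ∫ x : ι → ℝ, weight n l (x i) * ‖Φ x‖ ^ 2 :=
      integral_nonneg fun x => mul_nonneg (hw _) (sq_nonneg _)
    have h3 := mul_le_mul_of_nonneg_right (hbind i) h2
    rw [integral_add (i5 i) ((i2 i).const_mul κ), integral_sub (i1 i) (i3 i),
      integral_sub (i1 i) ((i2 i).const_mul E), integral_const_mul, integral_const_mul]
    linarith
  refine le_trans ?_ (Finset.sum_le_sum fun i _ => hterm i)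
  rw [← integral_finsetSum _ fun i _ => i6 i]
  have hconst : n * (n - 1) / 3 - 8 * Z * n =
      ∫ x, (n * (n - 1) / 3 - 8 * Z * n) * ‖Φ x‖ ^ 2 := by
    rw [integral_const_mul, hnorm, mul_one]
  rw [hconst]
  refine integral_mono (hΦ.integrable_normSq.const_mul _)
    (integrable_finsetSum _ fun i _ => i6 i) fun x => ?_
  -- The kinetic energy of particle i is discarded.
  have hdiff : ∀ i, weight n l (x i) * (potential Z V W x -
      potential (ι := {j : ι // j ≠ i}) Z (fun j => V j) (fun j k => W j k) (fun j => x j)) *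
        ‖Φ x‖ ^ 2 ≤ weight n l (x i) * energyDensity Z M V W Φ x -
      weight n l (x i) * energyDensityOmit i Z M V W Φ x := by
    intro i
    have h1 : ∑ j : {j : ι // j ≠ i}, partialNorm Φ j x ^ 2 ≤ ∑ j, partialNorm Φ j x ^ 2 := by
      rw [sum_subtype_ne i fun j => partialNorm Φ j x ^ 2]
      refine Finset.sum_le_sum fun j _ => ?_
      split_ifs
      exacts [sq_nonneg _, le_rfl]
    have h2 := mul_le_mul_of_nonneg_left h1 (by positivity : 0 ≤ 1 / M)
    rw [← mul_sub, mul_assoc]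
    refine mul_le_mul_of_nonneg_left ?_ (hw _)
    unfold energyDensity energyDensityOmit
    linarith
  have hsum : (∑ i, weight n l (x i) * (potential Z V W x -
      potential (ι := {j : ι // j ≠ i}) Z (fun j => V j) (fun j k => W j k) (fun j => x j)) +
        κ * ∑ i, weight n l (x i)) * ‖Φ x‖ ^ 2 ≤
      ∑ i, (weight n l (x i) * energyDensity Z M V W Φ x -
        weight n l (x i) * energyDensityOmit i Z M V W Φ x +
          κ * (weight n l (x i) * ‖Φ x‖ ^ 2)) := by
    rw [add_mul, Finset.sum_mul, Finset.sum_add_distrib, Finset.mul_sum, Finset.sum_mul]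
    refine add_le_add (Finset.sum_le_sum fun i _ => hdiff i) (le_of_eq ?_)
    exact Finset.sum_congr rfl fun i _ => by ring
  refine le_trans (mul_le_mul_of_nonneg_right ?_ (sq_nonneg _)) hsum
  rw [sum_mul_potential_sub]
  have h1 := le_sum_weight_add_repulsion h.W_nonneg hn hn1 hW hκ hl x
  have h2 : ∑ i, weight n l (x i) * V i (x i) ≤ ∑ _i : ι, 8 := by
    refine Finset.sum_le_sum fun i _ => ?_
    have h3 : 0 < √(x i ^ 2 + n) := Real.sqrt_pos.2 (by positivity)
    calc weight n l (x i) * V i (x i) ≤ √(x i ^ 2 + n) * (8 * (√(x i ^ 2 + n))⁻¹) :=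
          mul_le_mul (weight_le_sqrt hl0 _) (hV i _) (h.V_nonneg _ _) h3.le
      _ = 8 := by field_simp
  rw [Finset.sum_const, Finset.card_univ, nsmul_eq_mul, ← hn] at h2
  have h3 := mul_le_mul_of_nonneg_left h2 hZ.le
  linarith

/-- The number of bound particles is at most of order `Z S`, where `S` is a logarithm. -/
theorem BoundedPotentials.card_le_of_bound (h : BoundedPotentials V W C)
    (hV : ∀ j x, V j x ≤ 8 * (√(x ^ 2 + Fintype.card ι))⁻¹)
    (hW : ∀ j k x, j < k → (√(x ^ 2 + 4 * Fintype.card ι))⁻¹ ≤ W j k x)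
    (hW' : ∀ j k x, j < k → x ≠ 0 → W j k x ≤ |x|⁻¹)
    (hZ : 1 ≤ Z) (hM : 0 < M) (hS : 1 ≤ S) (hSM : Real.exp (-S) ≤ M)
    (hbind : ∀ i, groundEnergy Z M V W <
      groundEnergy (ι := {j : ι // j ≠ i}) Z M (fun j => V j) (fun j k => W j k)) :
    (Fintype.card ι : ℝ) ≤ 8000 * Z * S := by
  have hZS : 1 ≤ Z * S := one_le_mul_of_one_le_of_one_le hZ hS
  rcases isEmpty_or_nonempty ι with hι | hι
  · simp only [Fintype.card_eq_zero, Nat.cast_zero]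
    linarith
  obtain ⟨n, hn⟩ : ∃ n : ℝ, n = Fintype.card ι := ⟨_, rfl⟩
  have hn1 : 1 ≤ n := by
    rw [hn]
    exact_mod_cast Fintype.card_pos
  rw [← hn] at hV hW ⊢
  have hZ0 : 0 < Z := by linarith
  have hS0 : 0 < S := by linarith
  have hV' : ∀ j x, V j x ≤ 8 * (√(1 + x ^ 2))⁻¹ := fun j x =>
    (hV j x).trans (mul_le_mul_of_nonneg_left (inv_anti₀ (Real.sqrt_pos.2 (by positivity))
      (Real.sqrt_le_sqrt (by linarith))) (by norm_num))
  set E := groundEnergy Z M V W with hE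
  obtain ⟨i₀, hi₀⟩ := Finite.exists_min fun i =>
    groundEnergy (ι := {j : ι // j ≠ i}) Z M (fun j => V j) (fun j k => W j k)
  -- Finitely many strict inequalities leave a uniform gap κ. Its size affects l, s and δ, but not
  -- the final bound.
  obtain ⟨κ, hκ, hbind'⟩ : ∃ κ, 0 < κ ∧ ∀ i, E + κ ≤
      groundEnergy (ι := {j : ι // j ≠ i}) Z M (fun j => V j) (fun j k => W j k) :=
    ⟨_, sub_pos.2 (hbind i₀), fun i => by linarith [hi₀ i]⟩
  obtain ⟨l, hl⟩ : ∃ l, l = κ / (4 * n ^ 2) := ⟨_, rfl⟩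
  have hl0 : 0 < l := by rw [hl]; positivity
  -- The sum of the weights is at most n/l, so the first condition keeps the competitor admissible;
  -- the second bounds the quadratic localization error by 1.
  obtain ⟨s, hs0, hs1, hs2⟩ : ∃ s, 0 < s ∧ s * (n * (1 / l)) ≤ 1 / 2 ∧ n * s / (2 * M) ≤ 1 := by
    refine ⟨min (1 / 2 / (n * (1 / l))) (2 * M / n), by positivity, ?_, ?_⟩
    · exact (le_div_iff₀ (by positivity)).1 (min_le_left _ _)
    · rw [div_le_one (by positivity), mul_comm]
      exact (le_div_iff₀ (by positivity)).1 (min_le_right _ _)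
  obtain ⟨δ, hδ0, hδ1, hδ2⟩ : ∃ δ, 0 < δ ∧ δ ≤ s ∧ δ ≤ M * (Z * S) :=
    ⟨min s (M * (Z * S)), by positivity, min_le_left _ _, min_le_right _ _⟩
  obtain ⟨Φ, hΦ, hnorm, hlt⟩ := exists_energy_lt (Z := Z) (M := M) (V := V) (W := W) hδ0
  have hlow := h.le_integral_sum_weight_mul hn hn1 hV hV' hW hZ0 hM hκ hl hbind' hΦ hnorm
  have hsum : ∀ x : ι → ℝ, ∑ i, weight n l (x i) ≤ n * (1 / l) := fun x => by
    refine (Finset.sum_le_sum fun i _ => weight_le hl0 (x i)).trans (le_of_eq ?_)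
    rw [Finset.sum_const, Finset.card_univ, nsmul_eq_mul, ← hn]
  have hup := h.integral_mul_energyDensity_sub_le hV' hZ0 hM hΦ hnorm hlt.le
    (G := fun x => ∑ i, weight n l (x i))
    (ContDiff.sum fun i _ => (contDiff_weight (by linarith) hl0).comp (contDiff_apply ℝ ℝ i))
    (fun x => Finset.sum_nonneg fun i _ => weight_nonneg hl0 _) hsum
    (fun x j => fderiv_sum_weight (by linarith) hl0 x j) hs0 hs1
  have hkin := h.energy_lower_bound hV' hZ0 hM hS0 hΦ
  have hE0 := h.groundEnergy_nonpos hV' hW' hZ0 hM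
  rw [hnorm, ← hn, mul_one] at hkin
  rw [← hn] at hup
  set T := ∑ j, (∫ x, partialNorm Φ j x ^ 2) with hT
  -- Young's inequality with parameter Z S, which balances the two terms once the kinetic energy is
  -- known to be of order n M (Z S)².
  have hcross : 1 / M * ∑ j, (∫ x, ‖Φ x‖ * partialNorm Φ j x) ≤
      1 / (M * (Z * S)) * (1 / (2 * M) * T) + n * (Z * S) / 2 := by
    have h1 : ∀ j, 1 / M * (∫ x, ‖Φ x‖ * partialNorm Φ j x) ≤
        1 / (M * (Z * S)) * (1 / (2 * M) * ∫ x, partialNorm Φ j x ^ 2) + Z * S / 2 := by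
      intro j
      have i1 := hΦ.integrable_partialNormSq j
      have i2 := hΦ.integrable_normSq
      have h2 : ∫ x, 1 / M * (‖Φ x‖ * partialNorm Φ j x) ≤
          ∫ x, (1 / (M * (Z * S)) * (1 / (2 * M)) * partialNorm Φ j x ^ 2 +
            Z * S / 2 * ‖Φ x‖ ^ 2) := by
        refine integral_mono ((hΦ.integrable_norm_mul_partialNorm j).const_mul _)
          ((i1.const_mul _).add (i2.const_mul _)) fun x => ?_
        have h3 : 1 / (M * (Z * S)) * (1 / (2 * M)) * partialNorm Φ j x ^ 2 +
            Z * S / 2 * ‖Φ x‖ ^ 2 - 1 / M * (‖Φ x‖ * partialNorm Φ j x) =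
            1 / (Z * S) / 2 * (partialNorm Φ j x / M - Z * S * ‖Φ x‖) ^ 2 := by
          field_simp
          ring
        have h4 : 0 ≤ 1 / (Z * S) / 2 * (partialNorm Φ j x / M - Z * S * ‖Φ x‖) ^ 2 := by
          positivity
        show 1 / M * (‖Φ x‖ * partialNorm Φ j x) ≤ _
        linarith
      rw [integral_const_mul, integral_add (i1.const_mul _) (i2.const_mul _), integral_const_mul,
        integral_const_mul, hnorm] at h2
      linarith
    calc _ = ∑ j, 1 / M * (∫ x, ‖Φ x‖ * partialNorm Φ j x) := Finset.mul_sum _ _ _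
      _ ≤ ∑ j, (1 / (M * (Z * S)) * (1 / (2 * M) * ∫ x, partialNorm Φ j x ^ 2) + Z * S / 2) :=
        Finset.sum_le_sum fun j _ => h1 j
      _ = _ := by
        rw [Finset.sum_add_distrib, Finset.sum_const, Finset.card_univ, nsmul_eq_mul, ← hn,
          ← Finset.mul_sum, ← Finset.mul_sum]
        ring
  -- Since E ≤ 0, the energy of Φ is below δ ≤ M Z S. The constant 2064 is 64²/2 + 16, where exp(-S)
  -- ≤ M puts the truncation error on the same scale.
  have hTle : 1 / (2 * M) * T ≤ M * (Z * S) * (1 + n * 2064 * (Z * S)) := by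
    have h1 : 16 * Z * Real.exp (-S) ≤ 16 * (M * (Z * S) * (Z * S)) := by
      have h2 : Z * Real.exp (-S) ≤ Z * M := mul_le_mul_of_nonneg_left hSM hZ0.le
      have h3 : Z * M ≤ M * (Z * S) * (Z * S) := by
        have h4 : Z ≤ Z * S := le_mul_of_one_le_right hZ0.le hS
        have h5 : Z * S ≤ Z * S * (Z * S) := le_mul_of_one_le_right (by positivity) hZS
        calc Z * M ≤ Z * S * (Z * S) * M :=
              mul_le_mul_of_nonneg_right (h4.trans h5) hM.le
          _ = _ := by ring
      linarith
    have h5 : n * ((64 * Z * S) ^ 2 * M / 2 + 16 * Z * Real.exp (-S)) ≤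
        n * (2064 * (M * (Z * S) * (Z * S))) :=
      mul_le_mul_of_nonneg_left (by nlinarith) (by linarith)
    nlinarith
  have hTle' : 1 / (M * (Z * S)) * (1 / (2 * M) * T) ≤ 1 + n * 2064 * (Z * S) := by
    calc _ ≤ 1 / (M * (Z * S)) * (M * (Z * S) * (1 + n * 2064 * (Z * S))) :=
          mul_le_mul_of_nonneg_left hTle (by positivity)
      _ = _ := by field_simp
  have hδs : δ / s ≤ 1 := (div_le_one hs0).2 hδ1
  -- The 3 collects one unit each from δ/s, the quadratic localization error and δ in the kinetic
  -- bound.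
  have hfin : n * (n - 1) / 3 - 8 * Z * n ≤ 3 + n * 2065 * (Z * S) := by
    have : 0 ≤ n * (Z * S) := by positivity
    linarith
  have hZle : Z ≤ Z * S := le_mul_of_one_le_right hZ0.le hS
  have h1 : n * (n - 1) ≤ n * (6300 * (Z * S)) := by
    have h2 : n * Z ≤ n * (Z * S) := mul_le_mul_of_nonneg_left hZle (by linarith)
    have h3 : 1 ≤ n * (Z * S) := one_le_mul_of_one_le_of_one_le hn1 hZS
    nlinarith
  have h2 := le_of_mul_le_mul_left h1 (by linarith)
  linarith

end Abstract

-- Landau states: moments, orthogonality and density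

theorem continuous_landau (m : ℕ) : Continuous (landau m) := by
  unfold landau
  refine Continuous.mul (Complex.continuous_ofReal.comp ?_) (Complex.continuous_conj.pow m)
  fun_prop

theorem norm_landau_sq (m : ℕ) (z : ℂ) :
    ‖landau m z‖ ^ 2 = (Real.pi * m.factorial)⁻¹ * (‖z‖ ^ (2 * m) * Real.exp (-‖z‖ ^ 2)) := by
  have h1 : (0 : ℝ) ≤ Real.pi * m.factorial := by positivity
  have h2 : Real.exp (-‖z‖ ^ 2) = Real.exp (-‖z‖ ^ 2 / 2) ^ 2 := by
    rw [← Real.exp_nat_mul]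
    congr 1
    push_cast
    ring
  unfold landau
  rw [norm_mul, norm_pow, RCLike.norm_conj, Complex.norm_real, Real.norm_eq_abs, mul_pow, sq_abs,
    mul_pow, inv_pow, Real.sq_sqrt h1, h2]
  ring

theorem integral_norm_pow_mul_exp (k : ℕ) :
    ∫ z : ℂ, ‖z‖ ^ k * Real.exp (-‖z‖ ^ 2) = Real.pi * Real.Gamma ((k + 2) / 2) := by
  have := Complex.integral_rpow_mul_exp_neg_rpow (p := 2) (q := k) (by norm_num)
    (by have : (0 : ℝ) ≤ k := by positivity
        linarith)
  simp only [Real.rpow_natCast, Real.rpow_two] at this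
  rw [this]
  ring

theorem integrable_norm_pow_mul_exp (k : ℕ) :
    Integrable fun z : ℂ => ‖z‖ ^ k * Real.exp (-‖z‖ ^ 2) := by
  -- The integral of a nonintegrable function is 0 by convention, so a nonzero value proves
  -- integrability.
  refine Integrable.of_integral_ne_zero ?_
  rw [integral_norm_pow_mul_exp]
  exact (mul_pos Real.pi_pos (Real.Gamma_pos_of_pos (by positivity))).ne'

theorem integrable_one_add_norm_pow_mul_exp (m : ℕ) :
    Integrable fun z : ℂ => (1 + ‖z‖) ^ m * Real.exp (-‖z‖ ^ 2) := by
  have h1 : Integrable fun z : ℂ => ∑ i ∈ Finset.range (m + 1),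
      (m.choose i : ℝ) * (‖z‖ ^ i * Real.exp (-‖z‖ ^ 2)) :=
    integrable_finsetSum _ fun i _ => (integrable_norm_pow_mul_exp i).const_mul _
  refine h1.congr (Filter.Eventually.of_forall fun z => ?_)
  simp only
  rw [add_comm 1 ‖z‖, add_pow, Finset.sum_mul]
  exact Finset.sum_congr rfl fun i _ => by ring

theorem integrable_norm_landau_sq (m : ℕ) : Integrable fun z => ‖landau m z‖ ^ 2 := by
  simp only [norm_landau_sq]
  exact (integrable_norm_pow_mul_exp _).const_mul _

theorem integral_norm_landau_sq (m : ℕ) : ∫ z, ‖landau m z‖ ^ 2 = 1 := by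
  simp only [norm_landau_sq]
  rw [integral_const_mul, integral_norm_pow_mul_exp]
  have : ((2 * m : ℕ) + 2 : ℝ) / 2 = m + 1 := by
    push_cast
    ring
  rw [this, Real.Gamma_nat_eq_factorial]
  have := Real.pi_pos
  field_simp

theorem integrable_norm_landau_sq_mul_sq (m : ℕ) :
    Integrable fun z => ‖landau m z‖ ^ 2 * ‖z‖ ^ 2 := by
  refine ((integrable_norm_pow_mul_exp (2 * m + 2)).const_mul (Real.pi * m.factorial)⁻¹).congr
    (Filter.Eventually.of_forall fun z => ?_)
  simp only [norm_landau_sq]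
  ring

theorem integral_norm_landau_sq_mul_sq (m : ℕ) :
    ∫ z, ‖landau m z‖ ^ 2 * ‖z‖ ^ 2 = m + 1 := by
  have h1 : ∀ z, ‖landau m z‖ ^ 2 * ‖z‖ ^ 2 =
      (Real.pi * m.factorial)⁻¹ * (‖z‖ ^ (2 * m + 2) * Real.exp (-‖z‖ ^ 2)) := fun z => by
    rw [norm_landau_sq]
    ring
  simp only [h1]
  rw [integral_const_mul, integral_norm_pow_mul_exp]
  have : ((2 * m + 2 : ℕ) + 2 : ℝ) / 2 = (m + 1 : ℕ) + 1 := by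
    push_cast
    ring
  rw [this, Real.Gamma_nat_eq_factorial, Nat.factorial_succ]
  have := Real.pi_pos
  push_cast
  field_simp

theorem landau_rotate (m : ℕ) {c : ℂ} (hc : ‖c‖ = 1) (z : ℂ) :
    landau m (c * z) = starRingEnd ℂ c ^ m * landau m z := by
  unfold landau
  rw [norm_mul, hc, one_mul, map_mul, mul_pow]
  ring

/-- Rotating by the angle π/(n - m) preserves the measure and changes the sign of the integrand. -/
theorem integral_landau_mul_conj_of_ne {m n : ℕ} (hmn : m ≠ n) :
    ∫ z, landau m z * starRingEnd ℂ (landau n z) = 0 := by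
  have hne : ((n : ℂ) - m) ≠ 0 := sub_ne_zero.2 (by exact_mod_cast hmn.symm)
  set θ : ℝ := Real.pi / ((n : ℝ) - m) with hθ
  set c : Circle := Circle.exp θ with hc
  have hcn : ‖(c : ℂ)‖ = 1 := Circle.norm_coe c
  have hcz : (c : ℂ) = Complex.exp (θ * Complex.I) := Circle.coe_exp θ
  have hfac : starRingEnd ℂ (c : ℂ) ^ m * (c : ℂ) ^ n = -1 := by
    rw [hcz, ← Complex.exp_conj, ← Complex.exp_nat_mul, ← Complex.exp_nat_mul, ← Complex.exp_add,
      ← Complex.exp_pi_mul_I]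
    congr 1
    simp only [map_mul, Complex.conj_ofReal, Complex.conj_I, hθ]
    push_cast
    field_simp
    ring
  have h1 := (rotation c).measurePreserving.integral_comp
    (rotation c).toHomeomorph.measurableEmbedding
    (fun z => landau m z * starRingEnd ℂ (landau n z))
  have h2 : ∀ z, landau m (rotation c z) * starRingEnd ℂ (landau n (rotation c z)) =
      -(landau m z * starRingEnd ℂ (landau n z)) := by
    intro z
    rw [rotation_apply, landau_rotate m hcn, landau_rotate n hcn, map_mul, map_pow,
      Complex.conj_conj]
    calc _ = (starRingEnd ℂ (c : ℂ) ^ m * (c : ℂ) ^ n) *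
          (landau m z * starRingEnd ℂ (landau n z)) := by ring
      _ = _ := by rw [hfac, neg_one_mul]
  simp only [h2, integral_neg] at h1
  exact self_eq_neg.1 h1.symm

/-- The sum is exp(-|z|²)/π times a partial sum of the series of exp(|z|²). -/
theorem sum_norm_landau_sq_le (N : ℕ) (z : ℂ) :
    ∑ k : Fin N, ‖landau k z‖ ^ 2 ≤ 1 / Real.pi := by
  rw [Fin.sum_univ_eq_sum_range fun k => ‖landau k z‖ ^ 2]
  have h1 := Real.sum_le_exp_of_nonneg (sq_nonneg ‖z‖) N
  calc ∑ k ∈ Finset.range N, ‖landau k z‖ ^ 2 = 1 / Real.pi * Real.exp (-‖z‖ ^ 2) *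
        ∑ k ∈ Finset.range N, (‖z‖ ^ 2) ^ k / k.factorial := by
        rw [Finset.mul_sum]
        refine Finset.sum_congr rfl fun k _ => ?_
        rw [norm_landau_sq, ← pow_mul]
        have := Real.pi_pos
        field_simp
    _ ≤ 1 / Real.pi * Real.exp (-‖z‖ ^ 2) * Real.exp (‖z‖ ^ 2) :=
        mul_le_mul_of_nonneg_left h1 (by have := Real.pi_pos; positivity)
    _ = 1 / Real.pi := by rw [mul_assoc, ← Real.exp_add]; simp

-- Expansion of the determinant and its one-particle density

theorem continuous_slater (N : ℕ) : Continuous (slater N) := by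
  unfold slater
  refine continuous_const.mul (Continuous.matrix_det ?_)
  refine continuous_matrix fun j k => ?_
  exact (continuous_landau k).comp (continuous_apply j)

theorem norm_slater_sq_eq_sum (N : ℕ) (ζ : Fin N → ℂ) :
    ((‖slater N ζ‖ ^ 2 : ℝ) : ℂ) = ((N.factorial : ℂ))⁻¹ *
      ∑ σ : Equiv.Perm (Fin N), ∑ τ : Equiv.Perm (Fin N),
        ((Equiv.Perm.sign σ : ℤ) : ℂ) * ((Equiv.Perm.sign τ : ℤ) : ℂ) *
          ∏ l, landau (σ l) (ζ l) * starRingEnd ℂ (landau (τ l) (ζ l)) := by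
  have hdet : slater N ζ = (((√(N.factorial : ℝ))⁻¹ : ℝ) : ℂ) *
      ∑ σ : Equiv.Perm (Fin N), ((Equiv.Perm.sign σ : ℤ) : ℂ) * ∏ l, landau (σ l) (ζ l) := by
    unfold slater
    rw [← Matrix.det_transpose, Matrix.det_apply']
    simp
  have hfac : (((√(N.factorial : ℝ))⁻¹ : ℝ) : ℂ) * (((√(N.factorial : ℝ))⁻¹ : ℝ) : ℂ) =
      ((N.factorial : ℂ))⁻¹ := by
    rw [← Complex.ofReal_mul, ← mul_inv, Real.mul_self_sqrt (by positivity)]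
    simp
  rw [← Complex.normSq_eq_norm_sq, ← Complex.mul_conj, hdet, map_mul, Complex.conj_ofReal,
    mul_mul_mul_comm, hfac, map_sum, Finset.sum_mul_sum]
  congr 1
  refine Finset.sum_congr rfl fun σ _ => Finset.sum_congr rfl fun τ _ => ?_
  rw [map_mul, map_prod, Finset.prod_mul_distrib]
  simp only [map_intCast]
  ring

/-- Averaging over permutations. -/
theorem sum_perm_apply {N : ℕ} (A : Fin N → ℂ) (j : Fin N) :
    ∑ σ : Equiv.Perm (Fin N), A (σ j) = (N.factorial : ℂ) * ((N : ℂ)⁻¹ * ∑ k, A k) := by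
  have h1 : ∀ i, ∑ σ : Equiv.Perm (Fin N), A (σ i) = ∑ σ : Equiv.Perm (Fin N), A (σ j) := by
    intro i
    rw [← Equiv.sum_comp (Equiv.mulRight (Equiv.swap i j))]
    simp
  have h2 : (N : ℂ) * ∑ σ : Equiv.Perm (Fin N), A (σ j) = (N.factorial : ℂ) * ∑ k, A k := by
    calc (N : ℂ) * ∑ σ : Equiv.Perm (Fin N), A (σ j) =
          ∑ i, ∑ σ : Equiv.Perm (Fin N), A (σ i) := by
          rw [Finset.sum_congr rfl fun i _ => h1 i]
          simp
      _ = ∑ σ : Equiv.Perm (Fin N), ∑ k, A k := by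
          rw [Finset.sum_comm]
          exact Finset.sum_congr rfl fun σ _ => Equiv.sum_comp σ A
      _ = _ := by simp [Fintype.card_perm]
  have hN : (N : ℂ) ≠ 0 := by
    have := j.pos
    exact_mod_cast this.ne'
  calc _ = (N : ℂ)⁻¹ * ((N : ℂ) * ∑ σ : Equiv.Perm (Fin N), A (σ j)) := by
        rw [inv_mul_cancel_left₀ hN]
    _ = _ := by rw [h2]; ring

theorem perm_eq_of_eq_off {N : ℕ} {σ τ : Equiv.Perm (Fin N)} (j : Fin N)
    (h : ∀ l, l ≠ j → σ l = τ l) : σ = τ := by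
  have hj : σ j = τ j := by
    by_contra hne
    obtain ⟨l, hl⟩ := σ.surjective (τ j)
    have hlj : l ≠ j := fun h' => hne (by rw [← hl, h'])
    exact hlj (τ.injective (by rw [← h l hlj, hl]))
  ext l
  by_cases hl : l = j
  · rw [hl, hj]
  · rw [h l hl]

theorem integrable_landau_mul_conj_mul {F : ℂ → ℝ} (hF : Measurable F) {m n : ℕ}
    (hm : Integrable fun z => ‖landau m z‖ ^ 2 * F z)
    (hn : Integrable fun z => ‖landau n z‖ ^ 2 * F z) :
    Integrable fun z => landau m z * starRingEnd ℂ (landau n z) * (F z : ℂ) := by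
  refine (hm.norm.add hn.norm).mono ?_ (Filter.Eventually.of_forall fun z => ?_)
  · refine Measurable.aestronglyMeasurable ?_
    exact ((continuous_landau m).mul
      (Complex.continuous_conj.comp (continuous_landau n))).measurable.mul
      (Complex.measurable_ofReal.comp hF)
  · simp only [Pi.add_apply, norm_mul, RCLike.norm_conj, Complex.norm_real, norm_pow, norm_norm]
    refine le_trans ?_ (Real.le_norm_self _)
    rw [← add_mul]
    refine mul_le_mul_of_nonneg_right ?_ (norm_nonneg _)
    nlinarith [sq_nonneg (‖landau m z‖ - ‖landau n z‖), sq_nonneg (‖landau m z‖),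
      sq_nonneg (‖landau n z‖)]

/-- The one-particle density of the Slater determinant is the average of the densities of its
orbitals. -/
theorem slater_one_body {N : ℕ} (j : Fin N) {F : ℂ → ℝ} (hF : Measurable F)
    (hFi : ∀ k : Fin N, Integrable fun z => ‖landau k z‖ ^ 2 * F z) :
    (Integrable fun ζ : Fin N → ℂ => ‖slater N ζ‖ ^ 2 * F (ζ j)) ∧
      ∫ ζ : Fin N → ℂ, ‖slater N ζ‖ ^ 2 * F (ζ j) =
        (N : ℝ)⁻¹ * ∑ k : Fin N, ∫ z, ‖landau k z‖ ^ 2 * F z := by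
  -- The observable is put into slot j, so that every term of the Leibniz expansion remains a
  -- product of functions of one variable.
  let f : Equiv.Perm (Fin N) → Equiv.Perm (Fin N) → Fin N → ℂ → ℂ := fun σ τ l z =>
    landau (σ l) z * starRingEnd ℂ (landau (τ l) z) * (if l = j then (F z : ℂ) else 1)
  have hfi : ∀ σ τ l, Integrable (f σ τ l) := by
    intro σ τ l
    by_cases hl : l = j
    · simpa only [f, hl, if_true] using integrable_landau_mul_conj_mul hF (hFi _) (hFi _)
    · have := integrable_landau_mul_conj_mul (F := fun _ => 1) (m := σ l) (n := τ l)
        measurable_const (by simpa using integrable_norm_landau_sq _)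
        (by simpa using integrable_norm_landau_sq _)
      simpa [f, hl] using this
  have hexp : ∀ ζ : Fin N → ℂ, ((‖slater N ζ‖ ^ 2 * F (ζ j) : ℝ) : ℂ) = (N.factorial : ℂ)⁻¹ *
      ∑ σ : Equiv.Perm (Fin N), ∑ τ : Equiv.Perm (Fin N),
        ((Equiv.Perm.sign σ : ℤ) : ℂ) * ((Equiv.Perm.sign τ : ℤ) : ℂ) * ∏ l, f σ τ l (ζ l) := by
    intro ζ
    rw [Complex.ofReal_mul, norm_slater_sq_eq_sum, mul_assoc, Finset.sum_mul]
    simp only [Finset.sum_mul, f, Finset.prod_mul_distrib, Finset.prod_ite_eq', Finset.mem_univ,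
      if_true, mul_assoc]
  have hpi : ∀ σ τ, Integrable fun ζ : Fin N → ℂ => ∏ l, f σ τ l (ζ l) := fun σ τ =>
    Integrable.fintype_prod (hfi σ τ)
  have hterm : ∀ σ τ, Integrable fun ζ : Fin N → ℂ => ((Equiv.Perm.sign σ : ℤ) : ℂ) *
      ((Equiv.Perm.sign τ : ℤ) : ℂ) * ∏ l, f σ τ l (ζ l) := fun σ τ => (hpi σ τ).const_mul _
  have hint : Integrable fun ζ : Fin N → ℂ => ((‖slater N ζ‖ ^ 2 * F (ζ j) : ℝ) : ℂ) := by
    simp only [hexp]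
    exact (integrable_finsetSum _ fun σ _ => integrable_finsetSum _ fun τ _ =>
      hterm σ τ).const_mul _
  refine ⟨hint.re, ?_⟩
  -- Distinct permutations cannot differ at j alone, so some slot without F pairs two orthogonal
  -- Landau states.
  have hoff : ∀ σ τ, σ ≠ τ → ∫ ζ : Fin N → ℂ, ∏ l, f σ τ l (ζ l) = 0 := by
    intro σ τ hστ
    rw [integral_fintype_prod_volume_eq_prod]
    obtain ⟨l, hl, hne⟩ : ∃ l, l ≠ j ∧ σ l ≠ τ l := by
      by_contra hcon
      push Not at hcon
      exact hστ (perm_eq_of_eq_off j hcon)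
    refine Finset.prod_eq_zero (Finset.mem_univ l) ?_
    simp only [f, hl, if_false, mul_one]
    exact integral_landau_mul_conj_of_ne fun h => hne (Fin.ext h)
  have hself : ∀ m z, landau m z * starRingEnd ℂ (landau m z) = ((‖landau m z‖ ^ 2 : ℝ) : ℂ) :=
    fun m z => by rw [Complex.mul_conj, Complex.normSq_eq_norm_sq]
  have hdiag : ∀ σ, ∫ ζ : Fin N → ℂ, ∏ l, f σ σ l (ζ l) =
      ((∫ z, ‖landau (σ j) z‖ ^ 2 * F z : ℝ) : ℂ) := by
    intro σ
    rw [integral_fintype_prod_volume_eq_prod, Finset.prod_eq_single j]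
    · simp only [f, if_true, hself, ← Complex.ofReal_mul]
      exact integral_ofReal
    · intro l _ hl
      simp only [f, hl, if_false, mul_one, hself]
      rw [integral_complex_ofReal, integral_norm_landau_sq, Complex.ofReal_one]
    · simp
  have hsign : ∀ σ : Equiv.Perm (Fin N),
      ((Equiv.Perm.sign σ : ℤ) : ℂ) * ((Equiv.Perm.sign σ : ℤ) : ℂ) = 1 := fun σ => by
    rw [← Int.cast_mul, ← Units.val_mul, Int.units_mul_self]
    simp
  have hmain : ((∫ ζ : Fin N → ℂ, ‖slater N ζ‖ ^ 2 * F (ζ j) : ℝ) : ℂ) =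
      ((N : ℝ)⁻¹ * ∑ k : Fin N, ∫ z, ‖landau k z‖ ^ 2 * F z : ℝ) := by
    rw [← integral_complex_ofReal]
    simp only [hexp]
    rw [integral_const_mul, integral_finsetSum _ fun σ _ => integrable_finsetSum _ fun τ _ =>
      hterm σ τ]
    have h1 : ∀ σ : Equiv.Perm (Fin N), ∫ ζ : Fin N → ℂ, ∑ τ : Equiv.Perm (Fin N),
        ((Equiv.Perm.sign σ : ℤ) : ℂ) * ((Equiv.Perm.sign τ : ℤ) : ℂ) * ∏ l, f σ τ l (ζ l) =
        ((∫ z, ‖landau (σ j) z‖ ^ 2 * F z : ℝ) : ℂ) := by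
      intro σ
      rw [integral_finsetSum _ fun τ _ => hterm σ τ, Finset.sum_eq_single σ]
      · rw [integral_const_mul, hdiag, hsign, one_mul]
      · intro τ _ hτ
        rw [integral_const_mul, hoff σ τ hτ.symm, mul_zero]
      · simp
    rw [Finset.sum_congr rfl fun σ _ => h1 σ,
      sum_perm_apply (fun k : Fin N => ((∫ z, ‖landau k z‖ ^ 2 * F z : ℝ) : ℂ)) j,
      inv_mul_cancel_left₀ (by exact_mod_cast N.factorial_ne_zero)]
    push_cast
    rfl
  exact Complex.ofReal_injective hmain

theorem integrable_norm_slater_sq {N : ℕ} (hN : 1 ≤ N) :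
    Integrable fun ζ : Fin N → ℂ => ‖slater N ζ‖ ^ 2 := by
  simpa using (slater_one_body (⟨0, hN⟩ : Fin N) (F := fun _ => 1) measurable_const
    (fun k => by simpa using integrable_norm_landau_sq k)).1

theorem integral_norm_slater_sq {N : ℕ} (hN : 1 ≤ N) :
    ∫ ζ : Fin N → ℂ, ‖slater N ζ‖ ^ 2 = 1 := by
  have h := (slater_one_body (⟨0, hN⟩ : Fin N) (F := fun _ => 1) measurable_const
    (fun k => by simpa using integrable_norm_landau_sq k)).2
  have hN0 : (N : ℝ) ≠ 0 := by positivity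
  simpa [integral_norm_landau_sq, hN0] using h

/-- Particles of the determinant are confined to a disk of radius of order `√N`. -/
theorem integral_norm_slater_sq_mul_sq_le {N : ℕ} (j : Fin N) :
    (Integrable fun ζ : Fin N → ℂ => ‖slater N ζ‖ ^ 2 * ‖ζ j‖ ^ 2) ∧
      ∫ ζ : Fin N → ℂ, ‖slater N ζ‖ ^ 2 * ‖ζ j‖ ^ 2 ≤ N := by
  obtain ⟨h1, h2⟩ := slater_one_body j (F := fun z => ‖z‖ ^ 2) (by fun_prop)
    (fun k => integrable_norm_landau_sq_mul_sq k)
  refine ⟨h1, h2.trans_le ?_⟩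
  simp only [integral_norm_landau_sq_mul_sq]
  have hN : (0 : ℝ) < N := by exact_mod_cast j.pos
  have h3 : ∑ k : Fin N, (((k : ℕ) : ℝ) + 1) ≤ ∑ _k : Fin N, (N : ℝ) :=
    Finset.sum_le_sum fun k _ => by exact_mod_cast k.2
  calc (N : ℝ)⁻¹ * ∑ k : Fin N, (((k : ℕ) : ℝ) + 1) ≤ (N : ℝ)⁻¹ * ∑ _k : Fin N, (N : ℝ) :=
        mul_le_mul_of_nonneg_left h3 (by positivity)
    _ = N := by simp [hN.ne']

-- Bounds on the effective nuclear potential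

theorem inv_sqrt_add_le_inv_abs (x r : ℝ) (hx : x ≠ 0) : (√(x ^ 2 + r ^ 2))⁻¹ ≤ |x|⁻¹ :=
  inv_anti₀ (abs_pos.2 hx) (Real.abs_le_sqrt (by nlinarith [sq_nonneg r]))

theorem measurable_effV {N : ℕ} (j : Fin N) : Measurable (effV (slater N) j) := by
  have h : StronglyMeasurable fun p : ℝ × (Fin N → ℂ) =>
      ‖slater N p.2‖ ^ 2 / √(p.1 ^ 2 + ‖p.2 j‖ ^ 2) := by
    refine Measurable.stronglyMeasurable ?_
    have := (continuous_slater N).measurable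
    fun_prop
  exact h.integral_prod_right.measurable

theorem measurable_effW {N : ℕ} (j k : Fin N) : Measurable (effW (slater N) j k) := by
  have h : StronglyMeasurable fun p : ℝ × (Fin N → ℂ) =>
      ‖slater N p.2‖ ^ 2 / √(p.1 ^ 2 + ‖p.2 j - p.2 k‖ ^ 2) := by
    refine Measurable.stronglyMeasurable ?_
    have := (continuous_slater N).measurable
    fun_prop
  exact h.integral_prod_right.measurable

/-- A positive multiple of `e^{-b‖z‖}/‖z‖` bounds the singular part of the Coulomb potential. -/
theorem integral_inv_norm_mul_exp {b : ℝ} (hb : 0 < b) :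
    (Integrable fun z : ℂ => ‖z‖⁻¹ * Real.exp (-b * ‖z‖)) ∧
      ∫ z : ℂ, ‖z‖⁻¹ * Real.exp (-b * ‖z‖) = 2 * Real.pi / b := by
  have h := Complex.integral_rpow_mul_exp_neg_mul_rpow (p := 1) (q := -1) le_rfl
    (by norm_num) hb
  simp only [Real.rpow_one, Real.rpow_neg_one, div_one] at h
  rw [show (-(-1 + 2) : ℝ) = -1 by norm_num, show (-1 + 2 : ℝ) = 1 by norm_num,
    Real.rpow_neg_one, Real.Gamma_one, mul_one] at h
  refine ⟨Integrable.of_integral_ne_zero ?_, h⟩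
  rw [h]
  have := Real.pi_pos
  positivity

/-- Outside radius R the potential is at most 1/R; inside, e · exp(-|z|/R) ≥ 1. The exponential
stands in for the indicator of the disk because its integral against 1/|z| is explicit. -/
theorem inv_sqrt_add_sq_le_of_ne {R : ℝ} (hR : 0 < R) (x : ℝ) {z : ℂ} (hz : z ≠ 0) :
    (√(x ^ 2 + ‖z‖ ^ 2))⁻¹ ≤ R⁻¹ + Real.exp 1 * (‖z‖⁻¹ * Real.exp (-R⁻¹ * ‖z‖)) := by
  have hz0 : 0 < ‖z‖ := norm_pos_iff.2 hz
  have h1 : (√(x ^ 2 + ‖z‖ ^ 2))⁻¹ ≤ ‖z‖⁻¹ :=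
    inv_anti₀ hz0 (Real.le_sqrt_of_sq_le (by nlinarith [sq_nonneg x]))
  refine h1.trans ?_
  rcases le_or_gt R ‖z‖ with h | h
  · have := inv_anti₀ hR h
    have : 0 ≤ Real.exp 1 * (‖z‖⁻¹ * Real.exp (-R⁻¹ * ‖z‖)) := by positivity
    linarith
  · have h2 : 1 ≤ Real.exp 1 * Real.exp (-R⁻¹ * ‖z‖) := by
      rw [← Real.exp_add]
      refine Real.one_le_exp ?_
      have : R⁻¹ * ‖z‖ ≤ 1 := by
        rw [inv_mul_le_iff₀ hR]
        linarith
      linarith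
    have h3 : ‖z‖⁻¹ ≤ ‖z‖⁻¹ * (Real.exp 1 * Real.exp (-R⁻¹ * ‖z‖)) :=
      le_mul_of_one_le_right (by positivity) h2
    have : 0 ≤ R⁻¹ := by positivity
    linarith

theorem norm_landau_sq_le (m : ℕ) (z : ℂ) : ‖landau m z‖ ^ 2 ≤ 1 / Real.pi :=
  (Finset.single_le_sum (f := fun k : Fin (m + 1) => ‖landau k z‖ ^ 2)
    (fun _ _ => sq_nonneg _) (Finset.mem_univ (Fin.last m))).trans (sum_norm_landau_sq_le (m + 1) z)

theorem ae_ne_zero_complex : ∀ᵐ z : ℂ, z ≠ 0 := by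
  simp [ae_iff]

theorem integrable_norm_landau_sq_mul_inv_sqrt (m : ℕ) (x : ℝ) :
    Integrable fun z => ‖landau m z‖ ^ 2 * (√(x ^ 2 + ‖z‖ ^ 2))⁻¹ := by
  have h1 : Integrable fun z : ℂ => ‖landau m z‖ ^ 2 +
      1 / Real.pi * (Real.exp 1 * (‖z‖⁻¹ * Real.exp (-1 * ‖z‖))) :=
    (integrable_norm_landau_sq m).add
      (((integral_inv_norm_mul_exp one_pos).1.const_mul _).const_mul _)
  refine h1.mono' ?_ ?_
  · refine Measurable.aestronglyMeasurable ?_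
    have := (continuous_landau m).measurable
    fun_prop
  · filter_upwards [ae_ne_zero_complex] with z hz
    rw [Real.norm_of_nonneg (by positivity)]
    have h2 := inv_sqrt_add_sq_le_of_ne one_pos x hz
    rw [inv_one] at h2
    calc _ ≤ ‖landau m z‖ ^ 2 * (1 + Real.exp 1 * (‖z‖⁻¹ * Real.exp (-1 * ‖z‖))) :=
          mul_le_mul_of_nonneg_left h2 (sq_nonneg _)
      _ = ‖landau m z‖ ^ 2 + ‖landau m z‖ ^ 2 *
          (Real.exp 1 * (‖z‖⁻¹ * Real.exp (-1 * ‖z‖))) := by ring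
      _ ≤ _ := by
        gcongr
        exact norm_landau_sq_le m z

theorem effV_eq {N : ℕ} (j : Fin N) (x : ℝ) : effV (slater N) j x =
    (N : ℝ)⁻¹ * ∑ k : Fin N, ∫ z, ‖landau k z‖ ^ 2 * (√(x ^ 2 + ‖z‖ ^ 2))⁻¹ :=
  (slater_one_body j (F := fun z => (√(x ^ 2 + ‖z‖ ^ 2))⁻¹) (by fun_prop)
    fun k => integrable_norm_landau_sq_mul_inv_sqrt k x).2

theorem effV_nonneg {N : ℕ} (j : Fin N) (x : ℝ) : 0 ≤ effV (slater N) j x :=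
  integral_nonneg fun ζ => by positivity

theorem effV_le_inv_abs {N : ℕ} (j : Fin N) {x : ℝ} (hx : x ≠ 0) :
    effV (slater N) j x ≤ |x|⁻¹ := by
  have hN : (0 : ℝ) < N := by exact_mod_cast j.pos
  rw [effV_eq]
  have h1 : ∑ k : Fin N, ∫ z, ‖landau k z‖ ^ 2 * (√(x ^ 2 + ‖z‖ ^ 2))⁻¹ ≤
      ∑ _k : Fin N, |x|⁻¹ := by
    refine Finset.sum_le_sum fun k _ => ?_
    calc _ ≤ ∫ z, ‖landau k z‖ ^ 2 * |x|⁻¹ :=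
          integral_mono (integrable_norm_landau_sq_mul_inv_sqrt k x)
            ((integrable_norm_landau_sq k).mul_const _) fun z =>
            mul_le_mul_of_nonneg_left (inv_sqrt_add_le_inv_abs x _ hx) (sq_nonneg _)
      _ = |x|⁻¹ := by rw [integral_mul_const, integral_norm_landau_sq, one_mul]
  calc _ ≤ (N : ℝ)⁻¹ * ∑ _k : Fin N, |x|⁻¹ := mul_le_mul_of_nonneg_left h1 (by positivity)
    _ = |x|⁻¹ := by simp [hN.ne']

/-- The one-particle density is at most 1/(πN), so the singularity is spread over a disk of radius
√N. Splitting at R = √N gives the constant 1 + 2e ≤ 7. -/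
theorem effV_le_inv_sqrt {N : ℕ} (j : Fin N) (x : ℝ) :
    effV (slater N) j x ≤ 7 * (√(N : ℝ))⁻¹ := by
  have hN : (0 : ℝ) < N := by exact_mod_cast j.pos
  have hR : 0 < √(N : ℝ) := Real.sqrt_pos.2 hN
  have hpi := Real.pi_pos
  obtain ⟨i1, e1⟩ := integral_inv_norm_mul_exp (inv_pos.2 hR)
  have i2 : Integrable fun z : ℂ => ∑ k : Fin N, ‖landau k z‖ ^ 2 :=
    integrable_finsetSum _ fun k _ => integrable_norm_landau_sq k
  rw [effV_eq, ← integral_finsetSum Finset.univ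
    fun (k : Fin N) _ => integrable_norm_landau_sq_mul_inv_sqrt k x]
  have h1 : ∫ z, ∑ k : Fin N, ‖landau k z‖ ^ 2 * (√(x ^ 2 + ‖z‖ ^ 2))⁻¹ ≤
      ∫ z : ℂ, ((∑ k : Fin N, ‖landau k z‖ ^ 2) * (√(N : ℝ))⁻¹ +
        1 / Real.pi * (Real.exp 1 * (‖z‖⁻¹ * Real.exp (-(√(N : ℝ))⁻¹ * ‖z‖)))) := by
    refine integral_mono_ae
      (integrable_finsetSum _ fun k _ => integrable_norm_landau_sq_mul_inv_sqrt k x)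
      ((i2.mul_const _).add ((i1.const_mul _).const_mul _)) ?_
    filter_upwards [ae_ne_zero_complex] with z hz
    rw [← Finset.sum_mul]
    have h2 := inv_sqrt_add_sq_le_of_ne hR x hz
    have h3 : 0 ≤ ∑ k : Fin N, ‖landau k z‖ ^ 2 := Finset.sum_nonneg fun k _ => sq_nonneg _
    calc _ ≤ (∑ k : Fin N, ‖landau k z‖ ^ 2) * ((√(N : ℝ))⁻¹ +
          Real.exp 1 * (‖z‖⁻¹ * Real.exp (-(√(N : ℝ))⁻¹ * ‖z‖))) :=
          mul_le_mul_of_nonneg_left h2 h3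
      _ = (∑ k : Fin N, ‖landau k z‖ ^ 2) * (√(N : ℝ))⁻¹ + (∑ k : Fin N, ‖landau k z‖ ^ 2) *
          (Real.exp 1 * (‖z‖⁻¹ * Real.exp (-(√(N : ℝ))⁻¹ * ‖z‖))) := by ring
      _ ≤ _ := by
        gcongr
        exact sum_norm_landau_sq_le N z
  rw [integral_add (i2.mul_const _) ((i1.const_mul _).const_mul _), integral_mul_const,
    integral_const_mul, integral_const_mul, e1,
    integral_finsetSum Finset.univ fun (k : Fin N) _ => integrable_norm_landau_sq k] at h1
  simp only [integral_norm_landau_sq, Finset.sum_const, Finset.card_univ, Fintype.card_fin,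
    nsmul_eq_mul, mul_one] at h1
  have hsq : √(N : ℝ) * √(N : ℝ) = N := Real.mul_self_sqrt hN.le
  have h4 : (N : ℝ)⁻¹ * (N * (√(N : ℝ))⁻¹ +
      1 / Real.pi * (Real.exp 1 * (2 * Real.pi / (√(N : ℝ))⁻¹))) =
      (1 + 2 * Real.exp 1) * (√(N : ℝ))⁻¹ := by
    have : (N : ℝ)⁻¹ = (√(N : ℝ))⁻¹ * (√(N : ℝ))⁻¹ := by rw [← mul_inv, hsq]
    rw [mul_add, inv_mul_cancel_left₀ hN.ne', this]
    field_simp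
  have h5 := mul_le_mul_of_nonneg_left h1 (inv_nonneg.2 hN.le)
  rw [h4] at h5
  refine h5.trans (mul_le_mul_of_nonneg_right ?_ (by positivity))
  have := Real.exp_one_lt_d9
  linarith

/-- The effective nuclear potential is smeared out on the scale `√N`. -/
theorem effV_le {N : ℕ} (j : Fin N) (x : ℝ) :
    effV (slater N) j x ≤ 8 * (√(x ^ 2 + N))⁻¹ := by
  have hN : (0 : ℝ) < N := by exact_mod_cast j.pos
  have hR : 0 < √(N : ℝ) := Real.sqrt_pos.2 hN
  have hs : 0 < √(x ^ 2 + N) := Real.sqrt_pos.2 (by positivity)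
  set v := effV (slater N) j x with hv
  have hv0 : 0 ≤ v := effV_nonneg j x
  have h1 : (v * √(N : ℝ)) ≤ 7 := by
    have := mul_le_mul_of_nonneg_right (effV_le_inv_sqrt j x) hR.le
    rwa [inv_mul_cancel_right₀ hR.ne'] at this
  have h2 : v * |x| ≤ 1 := by
    rcases eq_or_ne x 0 with rfl | hx
    · simp
    · have := mul_le_mul_of_nonneg_right (effV_le_inv_abs j hx) (abs_nonneg x)
      rwa [inv_mul_cancel₀ (abs_ne_zero.2 hx)] at this
  -- Adding the squares of the two bounds gives 49 + 1 ≤ 64.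
  have h3 : v * √(x ^ 2 + N) ≤ 8 := by
    refine abs_le_of_sq_le_sq' ?_ (by norm_num) |>.2
    have h4 : (v * √(N : ℝ)) ^ 2 ≤ 7 ^ 2 := pow_le_pow_left₀ (by positivity) h1 2
    have h5 : (v * |x|) ^ 2 ≤ 1 ^ 2 := pow_le_pow_left₀ (by positivity) h2 2
    rw [mul_pow, Real.sq_sqrt hN.le] at h4
    rw [mul_pow, sq_abs] at h5
    rw [mul_pow, Real.sq_sqrt (by positivity)]
    nlinarith
  rw [← div_eq_mul_inv, le_div_iff₀ hs]
  exact h3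

-- Bounds on the effective repulsion

/-- The modulus of the determinant as a Vandermonde product times Gaussians. -/
theorem norm_slater_eq (N : ℕ) : ∃ c : ℝ, 0 ≤ c ∧ ∀ ζ : Fin N → ℂ, ‖slater N ζ‖ =
    c * (∏ l, Real.exp (-(‖ζ l‖ ^ 2) / 2)) * ∏ i, ∏ l ∈ Finset.Ioi i, ‖ζ l - ζ i‖ := by
  refine ⟨(√(N.factorial : ℝ))⁻¹ * ∏ k : Fin N, (√(Real.pi * ((k : ℕ).factorial : ℝ)))⁻¹,
    mul_nonneg (by positivity) (Finset.prod_nonneg fun k _ => by positivity), fun ζ => ?_⟩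
  have h1 : (Matrix.of fun j k : Fin N => landau (k : ℕ) (ζ j)) =
      Matrix.of fun j k : Fin N => ((Real.exp (-(‖ζ j‖ ^ 2) / 2) : ℝ) : ℂ) *
        (Matrix.of fun j k : Fin N => (((√(Real.pi * ((k : ℕ).factorial : ℝ)))⁻¹ : ℝ) : ℂ) *
          Matrix.vandermonde (fun j => starRingEnd ℂ (ζ j)) j k) j k := by
    ext j k
    simp only [Matrix.of_apply, Matrix.vandermonde_apply, landau]
    push_cast
    ring
  unfold slater
  rw [h1, Matrix.det_mul_column, Matrix.det_mul_row, Matrix.det_vandermonde]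
  simp only [norm_mul, norm_prod, Complex.norm_real, Real.norm_eq_abs, ← map_sub, RCLike.norm_conj]
  rw [abs_of_nonneg (by positivity)]
  have h2 : ∀ k : Fin N, |(√(Real.pi * ((k : ℕ).factorial : ℝ)))⁻¹| =
      (√(Real.pi * ((k : ℕ).factorial : ℝ)))⁻¹ := fun k => abs_of_nonneg (by positivity)
  simp only [h2, Real.abs_exp]
  ring

/-- The determinant vanishes at coinciding particles fast enough to compensate the singularity
of the repulsion. -/
theorem exists_norm_slater_sq_le (N : ℕ) : ∃ Q : (Fin N → ℂ) → ℝ, Integrable Q ∧ (∀ ζ, 0 ≤ Q ζ) ∧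
    ∀ ζ (j k : Fin N), j < k → ‖slater N ζ‖ ^ 2 ≤ ‖ζ j - ζ k‖ * Q ζ := by
  obtain ⟨c, hc, hsl⟩ := norm_slater_eq N
  let s : Finset (Σ _ : Fin N, Fin N) := Finset.univ.sigma fun i => Finset.Ioi i
  set q := s.card with hq
  refine ⟨fun ζ => c ^ 2 * ∏ l, ((1 + ‖ζ l‖) ^ (4 * q) * Real.exp (-‖ζ l‖ ^ 2)), ?_, ?_, ?_⟩
  · exact (Integrable.fintype_prod fun l : Fin N =>
      integrable_one_add_norm_pow_mul_exp (4 * q)).const_mul _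
  · exact fun ζ => mul_nonneg (sq_nonneg c) (Finset.prod_nonneg fun l _ => by positivity)
  · intro ζ j k hjk
    set P := ∏ l, (1 + ‖ζ l‖) with hP
    have hP1 : ∀ l, 1 + ‖ζ l‖ ≤ P := fun l => by
      rw [hP, ← Finset.mul_prod_erase _ _ (Finset.mem_univ l)]
      exact le_mul_of_one_le_right (by positivity)
        (Finset.prod_const_one.symm.trans_le (Finset.prod_le_prod (fun _ _ => zero_le_one)
          fun i _ => by linarith [norm_nonneg (ζ i)]))
    have hP2 : 1 ≤ P := (by linarith [norm_nonneg (ζ j)] : 1 ≤ 1 + ‖ζ j‖).trans (hP1 j)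
    have hf : ∀ p : Σ _ : Fin N, Fin N, ‖ζ p.2 - ζ p.1‖ ≤ P ^ 2 := by
      intro p
      have h1 := norm_sub_le (ζ p.2) (ζ p.1)
      have h2 : (1 + ‖ζ p.2‖) * (1 + ‖ζ p.1‖) ≤ P * P :=
        mul_le_mul (hP1 _) (hP1 _) (by positivity) (by linarith)
      nlinarith [mul_nonneg (norm_nonneg (ζ p.2)) (norm_nonneg (ζ p.1))]
    set D := ∏ i, ∏ l ∈ Finset.Ioi i, ‖ζ l - ζ i‖ with hD
    have hDs : D = ∏ p ∈ s, ‖ζ p.2 - ζ p.1‖ := by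
      rw [hD, Finset.prod_sigma']
    have hD0 : 0 ≤ D := by
      rw [hDs]
      exact Finset.prod_nonneg fun p _ => norm_nonneg _
    have hprod : ∀ t ⊆ s, ∏ p ∈ t, ‖ζ p.2 - ζ p.1‖ ≤ (P ^ 2) ^ q := by
      intro t ht
      calc ∏ p ∈ t, ‖ζ p.2 - ζ p.1‖ ≤ ∏ _p ∈ t, P ^ 2 :=
            Finset.prod_le_prod (fun p _ => norm_nonneg _) fun p _ => hf p
        _ = (P ^ 2) ^ t.card := Finset.prod_const _
        _ ≤ (P ^ 2) ^ q := pow_le_pow_right₀ (one_le_pow₀ hP2) (Finset.card_le_card ht)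
    have hmem : (⟨j, k⟩ : Σ _ : Fin N, Fin N) ∈ s := by simp [s, hjk]
    -- One copy of the Vandermonde product keeps the factor of the pair (j, k); the other copy is
    -- bounded entirely by powers of P. The two copies of (P²)^q explain the exponent 4q.
    have h1 : D ≤ ‖ζ j - ζ k‖ * (P ^ 2) ^ q := by
      rw [hDs, ← Finset.mul_prod_erase _ _ hmem, norm_sub_rev (ζ j)]
      exact mul_le_mul_of_nonneg_left (hprod _ (Finset.erase_subset _ _)) (norm_nonneg _)
    have h2 : D ≤ (P ^ 2) ^ q := by
      rw [hDs]
      exact hprod s subset_rfl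
    have h3 : D ^ 2 ≤ ‖ζ j - ζ k‖ * P ^ (4 * q) := by
      calc D ^ 2 = D * D := sq D
        _ ≤ ‖ζ j - ζ k‖ * (P ^ 2) ^ q * (P ^ 2) ^ q := mul_le_mul h1 h2 hD0 (by positivity)
        _ = _ := by ring
    have h4 : (∏ l, Real.exp (-(‖ζ l‖ ^ 2) / 2)) ^ 2 = ∏ l, Real.exp (-‖ζ l‖ ^ 2) := by
      rw [← Finset.prod_pow]
      refine Finset.prod_congr rfl fun l _ => ?_
      rw [← Real.exp_nat_mul]
      congr 1
      push_cast
      ring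
    show _ ≤ ‖ζ j - ζ k‖ * (c ^ 2 * ∏ l, ((1 + ‖ζ l‖) ^ (4 * q) * Real.exp (-‖ζ l‖ ^ 2)))
    rw [hsl, mul_pow, mul_pow, h4, Finset.prod_mul_distrib, Finset.prod_pow]
    have h5 : 0 ≤ c ^ 2 * ∏ l, Real.exp (-‖ζ l‖ ^ 2) :=
      mul_nonneg (sq_nonneg c) (Finset.prod_nonneg fun l _ => (Real.exp_pos _).le)
    calc _ ≤ c ^ 2 * (∏ l, Real.exp (-‖ζ l‖ ^ 2)) * (‖ζ j - ζ k‖ * P ^ (4 * q)) :=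
          mul_le_mul_of_nonneg_left h3 h5
      _ = _ := by ring

theorem norm_slater_sq_div_sqrt_le {N : ℕ} {Q : (Fin N → ℂ) → ℝ} (hQ0 : ∀ ζ, 0 ≤ Q ζ)
    (hQ : ∀ ζ (j k : Fin N), j < k → ‖slater N ζ‖ ^ 2 ≤ ‖ζ j - ζ k‖ * Q ζ)
    {j k : Fin N} (hjk : j < k) (x : ℝ) (ζ : Fin N → ℂ) :
    ‖slater N ζ‖ ^ 2 / √(x ^ 2 + ‖ζ j - ζ k‖ ^ 2) ≤ Q ζ := by
  refine div_le_of_le_mul₀ (Real.sqrt_nonneg _) (hQ0 ζ) ((hQ ζ j k hjk).trans ?_)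
  rw [mul_comm]
  exact mul_le_mul_of_nonneg_left (Real.le_sqrt_of_sq_le (by nlinarith [sq_nonneg x])) (hQ0 ζ)

theorem integrable_effW {N : ℕ} {j k : Fin N} (hjk : j < k) (x : ℝ) :
    Integrable fun ζ : Fin N → ℂ => ‖slater N ζ‖ ^ 2 / √(x ^ 2 + ‖ζ j - ζ k‖ ^ 2) := by
  obtain ⟨Q, hQi, hQ0, hQ⟩ := exists_norm_slater_sq_le N
  refine hQi.mono' ?_ (Filter.Eventually.of_forall fun ζ => ?_)
  · refine Measurable.aestronglyMeasurable ?_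
    have := (continuous_slater N).measurable
    fun_prop
  · rw [Real.norm_of_nonneg (by positivity)]
    exact norm_slater_sq_div_sqrt_le hQ0 hQ hjk x ζ

theorem exists_effW_le (N : ℕ) :
    ∃ C, ∀ (j k : Fin N) (x : ℝ), j < k → effW (slater N) j k x ≤ C := by
  obtain ⟨Q, hQi, hQ0, hQ⟩ := exists_norm_slater_sq_le N
  exact ⟨∫ ζ, Q ζ, fun j k x hjk => integral_mono (integrable_effW hjk x) hQi fun ζ =>
    norm_slater_sq_div_sqrt_le hQ0 hQ hjk x ζ⟩

theorem effW_nonneg {N : ℕ} (j k : Fin N) (x : ℝ) : 0 ≤ effW (slater N) j k x :=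
  integral_nonneg fun ζ => by positivity

theorem effW_le_inv_abs {N : ℕ} {j k : Fin N} (hjk : j < k) {x : ℝ} (hx : x ≠ 0) :
    effW (slater N) j k x ≤ |x|⁻¹ := by
  have hN : 1 ≤ N := j.pos
  calc effW (slater N) j k x ≤ ∫ ζ : Fin N → ℂ, ‖slater N ζ‖ ^ 2 * |x|⁻¹ :=
        integral_mono (integrable_effW hjk x) ((integrable_norm_slater_sq hN).mul_const _)
          fun ζ => mul_le_mul_of_nonneg_left (inv_sqrt_add_le_inv_abs x _ hx) (sq_nonneg _)
    _ = |x|⁻¹ := by rw [integral_mul_const, integral_norm_slater_sq hN, one_mul]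

/-- The tangent line of the convex function `s ↦ s^{-1/2}`. -/
theorem tangent_le_inv_sqrt {s t : ℝ} (hs : 0 < s) (ht : 0 < t) :
    3 / 2 * (√t)⁻¹ - s / 2 * (t⁻¹ * (√t)⁻¹) ≤ (√s)⁻¹ := by
  have hv := Real.sqrt_pos.2 hs
  have hw := Real.sqrt_pos.2 ht
  have hs2 := Real.sq_sqrt hs.le
  have ht2 := Real.sq_sqrt ht.le
  set v := √s
  set w := √t
  rw [← hs2, ← ht2, ← sub_nonneg]
  have : v⁻¹ - (3 / 2 * w⁻¹ - v ^ 2 / 2 * ((w ^ 2)⁻¹ * w⁻¹)) =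
      (v - w) ^ 2 * (v + 2 * w) / (2 * v * w ^ 3) := by
    field_simp
    ring
  rw [this]
  positivity

/-- Jensen's inequality for the effective repulsion. -/
theorem inv_sqrt_le_effW {N : ℕ} {j k : Fin N} (hjk : j < k) (x : ℝ) :
    (√(x ^ 2 + 4 * N))⁻¹ ≤ effW (slater N) j k x := by
  have hN : 1 ≤ N := j.pos
  have hN0 : (0 : ℝ) < N := by exact_mod_cast hN
  -- An upper bound for the mean of x² + |ζ_j - ζ_k|², since |ζ_j - ζ_k|² ≤ 2|ζ_j|² + 2|ζ_k|² and
  -- both second moments are at most N.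
  set t := x ^ 2 + 4 * (N : ℝ) with ht
  have ht0 : 0 < t := by positivity
  have hst : 0 < √t := Real.sqrt_pos.2 ht0
  set a := t⁻¹ * (√t)⁻¹ with ha
  have ha0 : 0 < a := by positivity
  obtain ⟨ij, ej⟩ := integral_norm_slater_sq_mul_sq_le j
  obtain ⟨ik, ek⟩ := integral_norm_slater_sq_mul_sq_le k
  have i0 := integrable_norm_slater_sq hN
  have hle : ∫ ζ : Fin N → ℂ, ((3 / 2 * (√t)⁻¹ - x ^ 2 / 2 * a) * ‖slater N ζ‖ ^ 2 -
      a * (‖slater N ζ‖ ^ 2 * ‖ζ j‖ ^ 2) - a * (‖slater N ζ‖ ^ 2 * ‖ζ k‖ ^ 2)) ≤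
      effW (slater N) j k x := by
    refine integral_mono (((i0.const_mul _).sub (ij.const_mul _)).sub (ik.const_mul _))
      (integrable_effW hjk x) fun ζ => ?_
    -- When the radicand is 0 the quotient has the default value 0 and the tangent bound is
    -- unavailable, but there the determinant has two equal rows.
    rcases (by positivity : 0 ≤ x ^ 2 + ‖ζ j - ζ k‖ ^ 2).eq_or_lt with h0 | h0
    · have h1 : ζ j = ζ k := by
        have : ‖ζ j - ζ k‖ ^ 2 = 0 := by nlinarith [sq_nonneg x, sq_nonneg ‖ζ j - ζ k‖]
        exact sub_eq_zero.1 (norm_eq_zero.1 (pow_eq_zero_iff two_ne_zero |>.1 this))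
      have h2 : slater N ζ = 0 := by
        unfold slater
        rw [Matrix.det_zero_of_row_eq hjk.ne (by ext l; simp [h1]), mul_zero]
      simp [h2]
    · have h1 := tangent_le_inv_sqrt h0 ht0
      have h2 : ‖ζ j - ζ k‖ ^ 2 ≤ 2 * ‖ζ j‖ ^ 2 + 2 * ‖ζ k‖ ^ 2 := by
        have h3 := pow_le_pow_left₀ (norm_nonneg _) (norm_sub_le (ζ j) (ζ k)) 2
        nlinarith [sq_nonneg (‖ζ j‖ - ‖ζ k‖)]
      have h3 : 3 / 2 * (√t)⁻¹ - x ^ 2 / 2 * a - a * ‖ζ j‖ ^ 2 - a * ‖ζ k‖ ^ 2 ≤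
          (√(x ^ 2 + ‖ζ j - ζ k‖ ^ 2))⁻¹ := by
        refine le_trans ?_ h1
        have := mul_le_mul_of_nonneg_right h2 ha0.le
        linarith
      have h4 := mul_le_mul_of_nonneg_left h3 (sq_nonneg ‖slater N ζ‖)
      refine le_trans (le_of_eq ?_) h4
      ring
  refine le_trans ?_ hle
  have i1 : Integrable fun ζ : Fin N → ℂ => (3 / 2 * (√t)⁻¹ - x ^ 2 / 2 * a) * ‖slater N ζ‖ ^ 2 -
      a * (‖slater N ζ‖ ^ 2 * ‖ζ j‖ ^ 2) := (i0.const_mul _).sub (ij.const_mul _)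
  rw [integral_sub i1 (ik.const_mul _), integral_sub (i0.const_mul _) (ij.const_mul _),
    integral_const_mul, integral_const_mul, integral_const_mul, integral_norm_slater_sq hN]
  have h1 := mul_le_mul_of_nonneg_left ej ha0.le
  have h2 := mul_le_mul_of_nonneg_left ek ha0.le
  have h3 : t * a = (√t)⁻¹ := by
    rw [ha, mul_inv_cancel_left₀ ht0.ne']
  have h4 : x ^ 2 * a + 4 * (N * a) = (√t)⁻¹ := by
    rw [← h3, ht]
    ring
  linarith

theorem exists_boundedPotentials (N : ℕ) :
    ∃ C, BoundedPotentials (effV (slater N)) (effW (slater N)) C := by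
  obtain ⟨C, hC⟩ := exists_effW_le N
  refine ⟨max C 7, measurable_effV, measurable_effW, effV_nonneg, fun j x => ?_, effW_nonneg,
    fun j k x hjk => (hC j k x hjk).trans (le_max_left _ _)⟩
  refine (effV_le_inv_sqrt j x).trans (le_trans ?_ (le_max_right _ _))
  have h1 : 1 ≤ √(N : ℝ) := Real.one_le_sqrt.2 (by exact_mod_cast j.pos)
  have := inv_le_one_of_one_le₀ h1
  linarith

-- Counting the bound electrons

/-- The number of bound electrons is at most of order `Z log B`. -/
theorem le_of_mem_boundNumbers {Z B : ℝ} (hZ : 1 ≤ Z) (hB : 0 < B) {N : ℕ}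
    (hN : N ∈ boundNumbers Z B) : (N : ℝ) ≤ 8000 * Z * (1 + Real.log (1 + √B)) := by
  obtain ⟨-, hb⟩ := hN
  obtain ⟨C, hC⟩ := exists_boundedPotentials N
  have hsB : 0 < √B := Real.sqrt_pos.2 hB
  have hM : B ^ (-(1 / 2) : ℝ) = (√B)⁻¹ := by rw [Real.rpow_neg hB.le, Real.sqrt_eq_rpow]
  have hlog : 0 ≤ Real.log (1 + √B) := Real.log_nonneg (by linarith)
  -- This S is at least 1 and satisfies exp(-S) ≤ 1/√B = M.
  have := hC.card_le_of_bound (Z := Z) (M := B ^ (-(1 / 2) : ℝ)) (S := 1 + Real.log (1 + √B))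
    (fun j x => by simpa using effV_le j x)
    (fun j k x hjk => by simpa using inv_sqrt_le_effW hjk x)
    (fun j k x hjk hx => effW_le_inv_abs hjk hx) hZ (by positivity) (by linarith) ?_ hb
  · simpa using this
  · rw [hM, neg_add, Real.exp_add, Real.exp_neg (Real.log _), Real.exp_log (by positivity)]
    calc Real.exp (-1) * (1 + √B)⁻¹ ≤ 1 * (1 + √B)⁻¹ :=
          mul_le_mul_of_nonneg_right (Real.exp_le_one_iff.2 (by norm_num)) (by positivity)
      _ ≤ (√B)⁻¹ := by
        rw [one_mul]
        exact inv_anti₀ hsB (by linarith)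

theorem bddAbove_and_Nmax_le {Z B R : ℝ} (hR : 0 ≤ R)
    (h : ∀ N ∈ boundNumbers Z B, (N : ℝ) ≤ R) :
    BddAbove (boundNumbers Z B) ∧ (Nmax Z B : ℝ) ≤ R := by
  have hb : BddAbove (boundNumbers Z B) := ⟨⌊R⌋₊, fun N hN => Nat.le_floor (h N hN)⟩
  refine ⟨hb, ?_⟩
  -- The supremum of the empty set in ℕ is 0, which is where R ≥ 0 enters.
  rcases (boundNumbers Z B).eq_empty_or_nonempty with he | hne
  · simpa [Nmax, he] using hR
  · exact h _ (Nat.sSup_mem hne hb)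

/-- Logarithmic bound from a bound of `√B`. -/
theorem log_one_add_le {b c y : ℝ} (hc : 0 ≤ c) (hb0 : 0 ≤ b) (hy : 0 ≤ y)
    (hb : b ≤ c * Real.exp y) : Real.log (1 + b) ≤ Real.log (1 + c) + y := by
  have h1 : 1 + b ≤ (1 + c) * Real.exp y := by
    have := Real.one_le_exp hy
    linarith
  calc Real.log (1 + b) ≤ Real.log ((1 + c) * Real.exp y) := Real.log_le_log (by linarith) h1
    _ = _ := by rw [Real.log_mul (by positivity) (Real.exp_pos y).ne', Real.log_exp]

end SlaterModel

theorem mainTheorem4 :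
    (∀ a₁ a₂ α : ℝ, 0 < a₁ → 0 < a₂ → 0 < α →
      ∃ A : ℝ, 0 < A ∧ ∀ ε Z B : ℝ, 0 < ε → 1 ≤ Z →
        a₂ * Z ^ (3 + ε) ≤ B → B < a₁ * Real.exp (Z ^ (α / 4)) →
          BddAbove (SlaterModel.boundNumbers Z B) ∧
            (SlaterModel.Nmax Z B : ℝ) ≤ 4 * Z + A * Z ^ (1 + α)) ∧
    (∀ a p : ℝ, 0 < a → 3 < p →
      ∃ A : ℝ, 0 < A ∧ ∀ Z B : ℝ, 2 ≤ Z → B = a * Z ^ p →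
        BddAbove (SlaterModel.boundNumbers Z B) ∧
          (SlaterModel.Nmax Z B : ℝ) ≤ 6 * Z + A * Z * Real.log Z ^ 2) := by
  refine ⟨fun a₁ a₂ α h₁ h₂ hα => ?_, fun a p ha hp => ?_⟩
  · have hL : 0 ≤ Real.log (1 + √a₁) := Real.log_nonneg (by linarith [Real.sqrt_nonneg a₁])
    refine ⟨8000 * (2 + Real.log (1 + √a₁)), by positivity, fun ε Z B _ hZ hB1 hB2 => ?_⟩
    have hZ0 : 0 < Z := by linarith
    have hB : 0 < B := lt_of_lt_of_le (by positivity) hB1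
    refine SlaterModel.bddAbove_and_Nmax_le (by positivity) fun N hN =>
      (SlaterModel.le_of_mem_boundNumbers hZ hB hN).trans ?_
    have hy1 : 1 ≤ Z ^ α := Real.one_le_rpow hZ hα.le
    have hy2 : Z ^ (α / 4) ≤ Z ^ α := Real.rpow_le_rpow_of_exponent_le hZ (by linarith)
    have hy0 : 0 ≤ Z ^ (α / 4) := by positivity
    have hs : √B ≤ √a₁ * Real.exp (Z ^ (α / 4)) := by
      refine Real.sqrt_le_iff.2 ⟨by positivity, hB2.le.trans ?_⟩
      rw [mul_pow, Real.sq_sqrt h₁.le]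
      refine mul_le_mul_of_nonneg_left ?_ h₁.le
      -- Crude: the square root would halve the exponent, but exp(y) ≤ exp(y)² suffices.
      exact le_self_pow₀ (Real.one_le_exp hy0) two_ne_zero
    have hlog := SlaterModel.log_one_add_le (Real.sqrt_nonneg a₁) (Real.sqrt_nonneg B) hy0 hs
    have h3 : 1 + Real.log (1 + √B) ≤ (2 + Real.log (1 + √a₁)) * Z ^ α := by nlinarith
    rw [Real.rpow_add hZ0, Real.rpow_one]
    calc 8000 * Z * (1 + Real.log (1 + √B)) ≤
          8000 * Z * ((2 + Real.log (1 + √a₁)) * Z ^ α) :=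
          mul_le_mul_of_nonneg_left h3 (by positivity)
      _ ≤ _ := by linarith
  · have hL : 0 ≤ Real.log (1 + √a) := Real.log_nonneg (by linarith [Real.sqrt_nonneg a])
    refine ⟨8000 * (4 * (1 + Real.log (1 + √a)) + 2 * p), by positivity, fun Z B hZ hB' => ?_⟩
    have hZ0 : 0 < Z := by linarith
    have hB : 0 < B := by rw [hB']; positivity
    refine SlaterModel.bddAbove_and_Nmax_le (by positivity) fun N hN =>
      (SlaterModel.le_of_mem_boundNumbers (by linarith) hB hN).trans ?_
    -- From Z ≥ 2; it lets (log Z)² dominate both constants and log Z, through 1 ≤ 4 (log Z)² and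
    -- log Z ≤ 2 (log Z)².
    have hl : 1 / 2 ≤ Real.log Z := by
      have h1 := Real.log_two_gt_d9
      have h2 := Real.log_le_log two_pos hZ
      linarith
    have hy0 : 0 ≤ p / 2 * Real.log Z := by positivity
    have hs : √B ≤ √a * Real.exp (p / 2 * Real.log Z) := by
      refine Real.sqrt_le_iff.2 ⟨by positivity, le_of_eq ?_⟩
      rw [mul_pow, Real.sq_sqrt ha.le, hB', Real.rpow_def_of_pos hZ0, ← Real.exp_nat_mul]
      congr 2
      push_cast
      ring
    have hlog := SlaterModel.log_one_add_le (Real.sqrt_nonneg a) (Real.sqrt_nonneg B) hy0 hs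
    have hsq : Real.log Z ≤ 2 * Real.log Z ^ 2 := by nlinarith
    have h1 : 1 ≤ 4 * Real.log Z ^ 2 := by nlinarith
    have h3 : 1 + Real.log (1 + √B) ≤
        (4 * (1 + Real.log (1 + √a)) + 2 * p) * Real.log Z ^ 2 := by
      have h4 := mul_le_mul_of_nonneg_left h1 (by linarith : 0 ≤ 1 + Real.log (1 + √a))
      have h5 := mul_le_mul_of_nonneg_left hsq (by linarith : 0 ≤ p / 2)
      have h6 : 0 ≤ p * Real.log Z ^ 2 := by positivity
      linarith
    calc 8000 * Z * (1 + Real.log (1 + √B)) ≤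
          8000 * Z * ((4 * (1 + Real.log (1 + √a)) + 2 * p) * Real.log Z ^ 2) :=
          mul_le_mul_of_nonneg_left h3 (by positivity)
      _ ≤ _ := by linarith
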